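/- Let $V$ be a complex vector space of dimension $2n$, and let $q$ be a nonzero quadratic form on $V$ of rank $2n-t$, that is, the symmetric matrix of $q$ in a basis of $V$ has rank $2n-t$. Let $Q_t=\{\mathbb{C}v\in\mathbb{P}V : q(v)=0\}$ be the corresponding quadric in $\mathbb{P}V\cong\mathbb{P}^{2n-1}$, with its classical (analytic) topology. Then the rational singular homology of $Q_t$ is finite-dimensional in total, and the topological Euler characteristic $\chi(Q_t)=\sum_i(-1)^i\dim H_i(Q_t;\mathbb{Q})$ is $$\chi(Q_t)=\begin{cases}2n-1,&\text{if } t \text{ is odd},\\ 2n,&\text{if } t\text{ is even}.\end{cases}$$ -/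

import Mathlib

open CategoryTheory AlgebraicTopology

/-- The topology of the projective space `ℙ(V)` of a topological complex vector space `V`: the
quotient topology of `V ∖ {0}` modulo scaling. For finite-dimensional Hausdorff `V` this is the
analytic (classical) topology. -/
instance projectiveSpaceTopology (V : Type*) [AddCommGroup V] [Module ℂ V] [TopologicalSpace V] :
    TopologicalSpace (Projectivization ℂ V) :=
  inferInstanceAs (TopologicalSpace (Quotient (projectivizationSetoid ℂ V)))

/-- The quadric of `q`: the set of all lines in `V` on which `q` vanishes. -/
def projectiveQuadric {V : Type*} [AddCommGroup V] [Module ℂ V] (q : QuadraticForm ℂ V) :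
    Set (Projectivization ℂ V) :=
  {x | ∀ v ∈ x.submodule, q v = 0}

/-- The rank of a quadratic form `q`: the rank of the linear map `V → V*` given by the symmetric
bilinear form `B` with `B(v, v) = q(v)`. The matrix of that map in a basis of `V` and its dual
basis is the symmetric matrix of `q`, with entries `a_ii` and `a_ij / 2`. -/
noncomputable def quadraticFormRank {V : Type*} [AddCommGroup V] [Module ℂ V]
    (q : QuadraticForm ℂ V) : ℕ :=
  Module.finrank ℂ (LinearMap.range (QuadraticMap.associated q))

/-- The singular chain complex of the space `X` with rational coefficients. -/
noncomputable def rationalSingularChains (X : Type) [TopologicalSpace X] :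
    ChainComplex (ModuleCat.{0} ℚ) ℕ :=
  ((singularChainComplexFunctor (ModuleCat.{0} ℚ)).obj (ModuleCat.of ℚ ℚ)).obj (TopCat.of X)

/-- The total rational singular homology of `X` is finite-dimensional, so that the
Euler characteristic of `X` is defined. -/
def HasFiniteRationalHomology (X : Type) [TopologicalSpace X] : Prop :=
  (∀ i : ℕ, Module.Finite ℚ ((rationalSingularChains X).homology i)) ∧
    ∃ N : ℕ, ∀ i : ℕ, N ≤ i → Subsingleton ((rationalSingularChains X).homology i)

/-- The Euler characteristic `∑ i, (-1) ^ i * dim H_i(X; ℚ)` of `X`. -/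
noncomputable def topologicalEulerChar (X : Type) [TopologicalSpace X] : ℤ :=
  (rationalSingularChains X).homologyEulerChar

/-!
After diagonalization the quadric is `z₁² + ⋯ + zᵣ² = 0` in the projective space with coordinates
`z₁, …, zᵣ, u₁, …, uₜ`, where `r = 2n - t`; its Euler characteristic is `r + t` for even `r` and
`r - 1 + t` for odd `r`.

The topological input is `χ(U ∪ W) = χ(U) + χ(W) - χ(U ∩ W)` for open sets
(`HasEulerChar.of_open_cover`). Here it rests on an algebraic Mayer–Vietoris argument
(`HasChainEulerChar.mayerVietoris`) and on the theorem on small simplices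
(`exists_sub_simplexBoundary_mem_smallChains`), which is proved by barycentric subdivision. Finiteness
of the total homology is carried along with the value of `χ`, in the predicate `HasEulerChar`.

Subsets of projective space are treated as complex cones `S ⊆ V ∖ {0}`, and the Euler characteristic
of the projectivization is tracked together with `χ(S) = 0`. The key step is the addition of one
coordinate `w` (`HasConeEulerChar.of_add_coordinate`): if `S'` in `V × ℂ` restricts to `S × ℂ` over
an open cone `U` of `V` that contains the slice `w = 0` of `S'`, then the projectivization of `S'` is
the union of an open set that retracts to the projectivization of `S` and of the affine chart
`w ≠ 0`, and these meet in a copy of `S`. Since `χ(S) = 0`, the Euler characteristic grows by that of the slice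
`w = 1`.

This is applied twice. The complement of `ℝP^(r-1)` in `ℂP^(r-1)` is the projectivization of the cone
`‖∑ zᵢ²‖ < ∑ ‖zᵢ‖²`. Its slice `zᵢ = 1` is the set of nonreal vectors, which retracts to a punctured
real space with Euler characteristic `0` or `2`; this gives `r` or `r - 1` for the complement. The
complement retracts to the smooth quadric, by moving `z` to `z + γ z̄`, where `γ` is the root of
absolute value less than `1` of a quadratic equation (`hasConeEulerChar_isotropicCone`). Then each of
the coordinates `u` adds a contractible slice (`hasConeEulerChar_singularIsotropicCone`).
-/

/-! ### Euler characteristics of chain complexes -/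

/-- The total homology of the chain complex `C` of rational vector spaces is finite-dimensional,
and its alternating sum of dimensions is `k`. -/
def HasChainEulerChar (C : ChainComplex (ModuleCat.{0} ℚ) ℕ) (k : ℤ) : Prop :=
  ((∀ i : ℕ, Module.Finite ℚ (C.homology i)) ∧
    ∃ N : ℕ, ∀ i : ℕ, N ≤ i → Subsingleton (C.homology i)) ∧ C.homologyEulerChar = k

lemma homologyEulerChar_eq_sum_range {C : ChainComplex (ModuleCat.{0} ℚ) ℕ} {N : ℕ}
    (h : ∀ i : ℕ, N ≤ i → Subsingleton (C.homology i)) :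
    C.homologyEulerChar =
      ∑ i ∈ Finset.range N, (-1 : ℤ) ^ i * Module.finrank ℚ (C.homology i) := by
  rw [HomologicalComplex.homologyEulerChar_eq_sum_finSet_of_finrankSupport_subset C
    (Finset.range N)]
  · refine Finset.sum_congr rfl fun i _ => ?_
    simp
  · rw [GradedObject.finrankSupport_subset_iff]
    intro i hi
    have := h i (by simpa using hi)
    exact Module.finrank_zero_of_subsingleton

lemma HasChainEulerChar.of_iso {C D : ChainComplex (ModuleCat.{0} ℚ) ℕ}
    (e : ∀ i, Nonempty (C.homology i ≃ₗ[ℚ] D.homology i)) {k : ℤ} (h : HasChainEulerChar C k) :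
    HasChainEulerChar D k := by
  obtain ⟨⟨hf, N, hN⟩, rfl⟩ := h
  have hN' : ∀ i : ℕ, N ≤ i → Subsingleton (D.homology i) := fun i hi =>
    have := hN i hi
    (e i).some.symm.toEquiv.subsingleton
  refine ⟨⟨fun i => have := hf i; Module.Finite.equiv (e i).some, N, hN'⟩, ?_⟩
  rw [homologyEulerChar_eq_sum_range hN, homologyEulerChar_eq_sum_range hN']
  exact Finset.sum_congr rfl fun i _ => by rw [(e i).some.finrank_eq]

lemma HasChainEulerChar.of_acyclic {C : ChainComplex (ModuleCat.{0} ℚ) ℕ}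
    (h : ∀ i, Subsingleton (C.homology i)) : HasChainEulerChar C 0 := by
  refine ⟨⟨fun i => have := h i; inferInstance, 0, fun i _ => h i⟩, ?_⟩
  rw [homologyEulerChar_eq_sum_range (N := 0) fun i _ => h i]
  simp

lemma HasChainEulerChar.of_degree_zero {C : ChainComplex (ModuleCat.{0} ℚ) ℕ}
    (h : ∀ i, i ≠ 0 → Subsingleton (C.homology i)) [Module.Finite ℚ (C.homology 0)] {k : ℕ}
    (hk : Module.finrank ℚ (C.homology 0) = k) : HasChainEulerChar C k := by
  have h' : ∀ i : ℕ, 1 ≤ i → Subsingleton (C.homology i) := fun i hi => h i (by omega)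
  refine ⟨⟨fun i => ?_, 1, h'⟩, ?_⟩
  · rcases eq_or_ne i 0 with rfl | hi
    · infer_instance
    · have := h i hi
      infer_instance
  · rw [homologyEulerChar_eq_sum_range h']
    simp [hk]

/-! ### Additivity in long exact sequences -/

section LongExactSequence

variable {K : Type*} [Field K]

lemma Function.Exact.finite_middle {A B C : Type*} [AddCommGroup A] [Module K A] [AddCommGroup B]
    [Module K B] [AddCommGroup C] [Module K C] {f : A →ₗ[K] B} {g : B →ₗ[K] C}
    (h : Function.Exact f g) [Module.Finite K A] [Module.Finite K C] : Module.Finite K B := by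
  have h1 : (LinearMap.ker g).FG := by
    rw [h.linearMap_ker_eq]
    exact Module.Finite.iff_fg.mp inferInstance
  have h2 : (Submodule.map g ⊤).FG := by
    exact Module.Finite.iff_fg.mp inferInstance
  exact ⟨Submodule.fg_of_fg_map_of_fg_inf_ker g h2 (by simpa using h1)⟩

lemma Function.Exact.finrank_middle {A B C : Type*} [AddCommGroup A] [Module K A] [AddCommGroup B]
    [Module K B] [AddCommGroup C] [Module K C] {f : A →ₗ[K] B} {g : B →ₗ[K] C}
    (h : Function.Exact f g) [Module.Finite K B] :
    Module.finrank K B =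
      Module.finrank K (LinearMap.range f) + Module.finrank K (LinearMap.range g) := by
  rw [← g.finrank_range_add_finrank_ker, h.linearMap_ker_eq, add_comm]

/-- In a long exact sequence `⋯ → A i → B i → C i → A (i - 1) → ⋯ → C 0 → 0` of
finite-dimensional spaces that vanishes in high degrees, alternating sums of dimensions are
additive: the ranks of the maps telescope. -/
lemma sum_finrank_of_longExact {A B C : ℕ → Type*}
    [∀ i, AddCommGroup (A i)] [∀ i, Module K (A i)]
    [∀ i, AddCommGroup (B i)] [∀ i, Module K (B i)]
    [∀ i, AddCommGroup (C i)] [∀ i, Module K (C i)]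
    [∀ i, Module.Finite K (A i)] [∀ i, Module.Finite K (B i)] [∀ i, Module.Finite K (C i)]
    (f : ∀ i, A i →ₗ[K] B i) (g : ∀ i, B i →ₗ[K] C i) (δ : ∀ i, C (i + 1) →ₗ[K] A i)
    (hA : ∀ i, Function.Exact (δ i) (f i)) (hB : ∀ i, Function.Exact (f i) (g i))
    (hC : ∀ i, Function.Exact (g (i + 1)) (δ i)) (hC0 : Function.Surjective (g 0))
    {N : ℕ} (hN : Subsingleton (A N)) :
    ∑ i ∈ Finset.range (N + 1), (-1 : ℤ) ^ i * Module.finrank K (B i) =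
      ∑ i ∈ Finset.range (N + 1), (-1 : ℤ) ^ i * Module.finrank K (A i) +
      ∑ i ∈ Finset.range (N + 1), (-1 : ℤ) ^ i * Module.finrank K (C i) := by
  have key : ∀ n : ℕ, ∑ i ∈ Finset.range (n + 1), (-1 : ℤ) ^ i * Module.finrank K (A i) +
      ∑ i ∈ Finset.range (n + 1), (-1 : ℤ) ^ i * Module.finrank K (C i) =
      ∑ i ∈ Finset.range (n + 1), (-1 : ℤ) ^ i * Module.finrank K (B i) +
        (-1) ^ n * Module.finrank K (LinearMap.range (δ n)) := by
    intro n
    induction n with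
    | zero =>
      have h : Module.finrank K (LinearMap.range (g 0)) = Module.finrank K (C 0) := by
        rw [LinearMap.range_eq_top.mpr hC0, finrank_top]
      simp [(hA 0).finrank_middle, (hB 0).finrank_middle, ← h]
      ring
    | succ n ih =>
      rw [Finset.sum_range_succ, Finset.sum_range_succ _ (n + 1),
        Finset.sum_range_succ _ (n + 1), (hA (n + 1)).finrank_middle,
        (hB (n + 1)).finrank_middle, (hC n).finrank_middle]
      push_cast
      rw [pow_succ]
      linear_combination ih
  have hz : Module.finrank K (LinearMap.range (δ N)) = 0 := Module.finrank_zero_of_subsingleton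
  rw [key N, hz]
  simp

end LongExactSequence

/-! ### Short exact sequences of complexes -/

section ShortExact

lemma Function.Exact.subsingleton_middle {A B C : Type*} [AddCommGroup A] [AddCommGroup B]
    [AddCommGroup C] {f : A →+ B} {g : B →+ C}
    (h : Function.Exact f g) [Subsingleton A] [Subsingleton C] : Subsingleton B := by
  refine subsingleton_of_forall_eq 0 fun b => ?_
  obtain ⟨a, rfl⟩ := (h b).mp (Subsingleton.elim _ _)
  rw [Subsingleton.elim a 0, map_zero]

variable {S : ShortComplex (ChainComplex (ModuleCat.{0} ℚ) ℕ)}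

lemma homology_function_exact₁ (hS : S.ShortExact) (i : ℕ) :
    Function.Exact (hS.δ (i + 1) i rfl).hom (HomologicalComplex.homologyMap S.f i).hom :=
  (ShortComplex.ShortExact.moduleCat_exact_iff_function_exact _).mp
    (hS.homology_exact₁ (i + 1) i rfl)

lemma homology_function_exact₂ (hS : S.ShortExact) (i : ℕ) :
    Function.Exact (HomologicalComplex.homologyMap S.f i).hom
      (HomologicalComplex.homologyMap S.g i).hom :=
  (ShortComplex.ShortExact.moduleCat_exact_iff_function_exact _).mp (hS.homology_exact₂ i)

lemma homology_function_exact₃ (hS : S.ShortExact) (i : ℕ) :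
    Function.Exact (HomologicalComplex.homologyMap S.g (i + 1)).hom (hS.δ (i + 1) i rfl).hom :=
  (ShortComplex.ShortExact.moduleCat_exact_iff_function_exact _).mp
    (hS.homology_exact₃ (i + 1) i rfl)

lemma homologyMap_zero_surjective (hS : S.ShortExact) :
    Function.Surjective (HomologicalComplex.homologyMap S.g 0).hom := by
  have := hS.epi_g
  have : Epi (HomologicalComplex.homologyMap S.g 0) :=
    HomologicalComplex.epi_homologyMap_of_epi_of_not_rel S.g 0 (by simp)
  exact (ModuleCat.epi_iff_surjective _).mp this

lemma homologyEulerChar_of_shortExact (hS : S.ShortExact)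
    (h₁ : (∀ i : ℕ, Module.Finite ℚ (S.X₁.homology i)) ∧
      ∃ N : ℕ, ∀ i : ℕ, N ≤ i → Subsingleton (S.X₁.homology i))
    (h₂ : (∀ i : ℕ, Module.Finite ℚ (S.X₂.homology i)) ∧
      ∃ N : ℕ, ∀ i : ℕ, N ≤ i → Subsingleton (S.X₂.homology i))
    (h₃ : (∀ i : ℕ, Module.Finite ℚ (S.X₃.homology i)) ∧
      ∃ N : ℕ, ∀ i : ℕ, N ≤ i → Subsingleton (S.X₃.homology i)) :
    S.X₂.homologyEulerChar = S.X₁.homologyEulerChar + S.X₃.homologyEulerChar := by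
  obtain ⟨f₁, N₁, h₁⟩ := h₁
  obtain ⟨f₂, N₂, h₂⟩ := h₂
  obtain ⟨f₃, N₃, h₃⟩ := h₃
  rw [homologyEulerChar_eq_sum_range (N := N₁ + N₂ + N₃ + 1) fun i hi => h₁ i (by omega),
    homologyEulerChar_eq_sum_range (N := N₁ + N₂ + N₃ + 1) fun i hi => h₂ i (by omega),
    homologyEulerChar_eq_sum_range (N := N₁ + N₂ + N₃ + 1) fun i hi => h₃ i (by omega)]
  exact sum_finrank_of_longExact _ _ _ (homology_function_exact₁ hS) (homology_function_exact₂ hS)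
    (homology_function_exact₃ hS) (homologyMap_zero_surjective hS) (h₁ _ (by omega))

lemma HasChainEulerChar.middle (hS : S.ShortExact) {a c : ℤ} (h₁ : HasChainEulerChar S.X₁ a)
    (h₃ : HasChainEulerChar S.X₃ c) : HasChainEulerChar S.X₂ (a + c) := by
  obtain ⟨h₁, rfl⟩ := h₁
  obtain ⟨h₃, rfl⟩ := h₃
  have h₂ : (∀ i : ℕ, Module.Finite ℚ (S.X₂.homology i)) ∧
      ∃ N : ℕ, ∀ i : ℕ, N ≤ i → Subsingleton (S.X₂.homology i) := by
    obtain ⟨f₁, N₁, h₁⟩ := h₁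
    obtain ⟨f₃, N₃, h₃⟩ := h₃
    refine ⟨fun i => (homology_function_exact₂ hS i).finite_middle, N₁ + N₃, fun i hi => ?_⟩
    have := h₁ i (by omega)
    have := h₃ i (by omega)
    exact Function.Exact.subsingleton_middle
      (f := (HomologicalComplex.homologyMap S.f i).hom.toAddMonoidHom)
      (g := (HomologicalComplex.homologyMap S.g i).hom.toAddMonoidHom)
      (homology_function_exact₂ hS i)
  exact ⟨h₂, homologyEulerChar_of_shortExact hS h₁ h₂ h₃⟩

lemma HasChainEulerChar.right (hS : S.ShortExact) {a b : ℤ} (h₁ : HasChainEulerChar S.X₁ a)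
    (h₂ : HasChainEulerChar S.X₂ b) : HasChainEulerChar S.X₃ (b - a) := by
  obtain ⟨h₁, rfl⟩ := h₁
  obtain ⟨h₂, rfl⟩ := h₂
  have h₃ : (∀ i : ℕ, Module.Finite ℚ (S.X₃.homology i)) ∧
      ∃ N : ℕ, ∀ i : ℕ, N ≤ i → Subsingleton (S.X₃.homology i) := by
    obtain ⟨f₁, N₁, h₁⟩ := h₁
    obtain ⟨f₂, N₂, h₂⟩ := h₂
    refine ⟨fun i => ?_, N₁ + N₂ + 1, fun i hi => ?_⟩
    · cases i with
      | zero =>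
        exact Module.Finite.of_surjective _ (homologyMap_zero_surjective hS)
      | succ i => exact (homology_function_exact₃ hS i).finite_middle
    · obtain ⟨i, rfl⟩ : ∃ j, i = j + 1 := ⟨i - 1, by omega⟩
      have := h₁ i (by omega)
      have := h₂ (i + 1) (by omega)
      exact Function.Exact.subsingleton_middle
        (f := (HomologicalComplex.homologyMap S.g (i + 1)).hom.toAddMonoidHom)
        (g := (hS.δ (i + 1) i rfl).hom.toAddMonoidHom)
        (homology_function_exact₃ hS i)
  refine ⟨h₃, ?_⟩
  have := homologyEulerChar_of_shortExact hS h₁ h₂ h₃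
  omega

lemma shortExact_of_injective_exact_surjective
    (hf : ∀ i, Function.Injective (S.f.f i).hom)
    (hfg : ∀ i, Function.Exact (S.f.f i).hom (S.g.f i).hom)
    (hg : ∀ i, Function.Surjective (S.g.f i).hom) : S.ShortExact :=
  HomologicalComplex.shortExact_of_degreewise_shortExact _ fun i =>
    ModuleCat.shortComplex_shortExact (S.map (HomologicalComplex.eval _ _ i))
      (hfg i) (hf i) (hg i)

end ShortExact

/-! ### Algebraic Mayer–Vietoris -/

section Constructions

variable (C : ChainComplex (ModuleCat.{0} ℚ) ℕ)

/-- The subcomplex of `C` given by a family of submodules stable under the differential. -/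
def subChainComplex (M : ∀ i, Submodule ℚ (C.X i))
    (hM : ∀ i j, M i ≤ (M j).comap (C.d i j).hom) : ChainComplex (ModuleCat.{0} ℚ) ℕ where
  X i := ModuleCat.of ℚ (M i)
  d i j := ModuleCat.ofHom ((C.d i j).hom.restrict (hM i j))
  shape i j h := by
    ext x
    simp [C.shape i j h]
  d_comp_d' i j k _ _ := by
    ext x
    exact congrArg (fun f => f.hom x.1) (C.d_comp_d i j k)

/-- The quotient of `C` by a family of submodules stable under the differential. -/
def quotientChainComplex (M : ∀ i, Submodule ℚ (C.X i))
    (hM : ∀ i j, M i ≤ (M j).comap (C.d i j).hom) : ChainComplex (ModuleCat.{0} ℚ) ℕ where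
  X i := ModuleCat.of ℚ (C.X i ⧸ M i)
  d i j := ModuleCat.ofHom ((M i).mapQ (M j) (C.d i j).hom (hM i j))
  shape i j h := by
    ext x
    simp [C.shape i j h]
  d_comp_d' i j k _ _ := by
    ext x
    have := congrArg (fun f => f.hom x) (C.d_comp_d i j k)
    simp only [ModuleCat.hom_comp, LinearMap.comp_apply] at this
    simp [this]

variable {C} in
/-- A subcomplex `M ⊆ C` has the Euler characteristic of `C` if every chain whose boundary lies in
`M` is homologous to a chain in `M` (so that `C / M` is acyclic). -/
lemma HasChainEulerChar.of_subChainComplex (M : ∀ i, Submodule ℚ (C.X i))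
    (hM : ∀ i j, M i ≤ (M j).comap (C.d i j).hom)
    (hsmall : ∀ i (c : C.X i), (∀ j, (C.d i j).hom c ∈ M j) →
      ∃ e : C.X (i + 1), c - (C.d (i + 1) i).hom e ∈ M i) {k : ℤ}
    (h : HasChainEulerChar (subChainComplex C M hM) k) : HasChainEulerChar C k := by
  let S : ShortComplex (ChainComplex (ModuleCat.{0} ℚ) ℕ) :=
    { X₁ := subChainComplex C M hM
      X₂ := C
      X₃ := quotientChainComplex C M hM
      f := { f := fun i => ModuleCat.ofHom (M i).subtype
             comm' := fun i j _ => rfl }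
      g := { f := fun i => ModuleCat.ofHom (M i).mkQ
             comm' := fun i j _ => rfl }
      zero := by
        ext i x
        exact (Submodule.Quotient.mk_eq_zero _).mpr x.2 }
  have hS : S.ShortExact := by
    refine shortExact_of_injective_exact_surjective (fun i => (M i).subtype_injective)
      (fun i => ?_) fun i => (M i).mkQ_surjective
    exact LinearMap.exact_subtype_mkQ (M i)
  have hQ : HasChainEulerChar S.X₃ 0 := by
    refine .of_acyclic fun i => ?_
    rw [← ModuleCat.isZero_iff_subsingleton, ← HomologicalComplex.exactAt_iff_isZero_homology,
      HomologicalComplex.exactAt_iff' _ (i + 1) i ((ComplexShape.down ℕ).next i) (by simp) rfl,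
      ShortComplex.moduleCat_exact_iff]
    intro x hx
    obtain ⟨c, rfl⟩ := (M i).mkQ_surjective x
    have hc : ∀ j, (C.d i j).hom c ∈ M j := by
      intro j
      by_cases hj : (ComplexShape.down ℕ).Rel i j
      · obtain rfl := (ComplexShape.down ℕ).next_eq' hj
        exact (Submodule.Quotient.mk_eq_zero _).mp hx
      · simp [C.shape i j hj]
    obtain ⟨e, he⟩ := hsmall i c hc
    refine ⟨(M (i + 1)).mkQ e, ?_⟩
    exact ((Submodule.Quotient.eq _).mpr he).symm
  have := HasChainEulerChar.middle hS h hQ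
  simpa using this

/-- The direct sum of two chain complexes. -/
def prodChainComplex (D : ChainComplex (ModuleCat.{0} ℚ) ℕ) :
    ChainComplex (ModuleCat.{0} ℚ) ℕ where
  X i := ModuleCat.of ℚ (C.X i × D.X i)
  d i j := ModuleCat.ofHom ((C.d i j).hom.prodMap (D.d i j).hom)
  shape i j h := by
    ext x <;> simp [C.shape i j h, D.shape i j h]
  d_comp_d' i j k _ _ := by
    apply ModuleCat.hom_ext
    exact LinearMap.ext fun x => Prod.ext (congrArg (fun f => f.hom x.1) (C.d_comp_d i j k))
      (congrArg (fun f => f.hom x.2) (D.d_comp_d i j k))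

variable {C} in
lemma HasChainEulerChar.prod {D : ChainComplex (ModuleCat.{0} ℚ) ℕ} {a b : ℤ}
    (h₁ : HasChainEulerChar C a) (h₂ : HasChainEulerChar D b) :
    HasChainEulerChar (prodChainComplex C D) (a + b) := by
  let S : ShortComplex (ChainComplex (ModuleCat.{0} ℚ) ℕ) :=
    { X₁ := C
      X₂ := prodChainComplex C D
      X₃ := D
      f := { f := fun i => ModuleCat.ofHom (LinearMap.inl ℚ (C.X i) (D.X i))
             comm' := fun i j _ => by
              ext x
              exact Prod.ext rfl (map_zero (D.d i j).hom) }
      g := { f := fun i => ModuleCat.ofHom (LinearMap.snd ℚ (C.X i) (D.X i))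
             comm' := fun i j _ => rfl }
      zero := rfl }
  have hS : S.ShortExact := shortExact_of_injective_exact_surjective
    (fun i => LinearMap.inl_injective) (fun i => .inl_snd) fun i => LinearMap.snd_surjective
  exact HasChainEulerChar.middle hS h₁ h₂

end Constructions

/-- Algebraic Mayer–Vietoris: if `A` and `B` are subcomplexes of `C` with intersection `P`, and
every chain of `C` whose boundary lies in `A + B` is homologous to a chain in `A + B`, then
`χ(C) = χ(A) + χ(B) - χ(P)`. -/
lemma HasChainEulerChar.mayerVietoris {P A B C : ChainComplex (ModuleCat.{0} ℚ) ℕ}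
    (iA : P ⟶ A) (iB : P ⟶ B) (fA : A ⟶ C) (fB : B ⟶ C) (comm : iA ≫ fA = iB ≫ fB)
    (hiA : ∀ i, Function.Injective (iA.f i).hom)
    (hpull : ∀ i (a : A.X i) (b : B.X i), (fA.f i).hom a = (fB.f i).hom b →
      ∃ p : P.X i, (iA.f i).hom p = a ∧ (iB.f i).hom p = b)
    (hsmall : ∀ i (c : C.X i),
      (∀ j, (C.d i j).hom c ∈ LinearMap.range (fA.f j).hom ⊔ LinearMap.range (fB.f j).hom) →
      ∃ e : C.X (i + 1), c - (C.d (i + 1) i).hom e ∈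
        LinearMap.range (fA.f i).hom ⊔ LinearMap.range (fB.f i).hom)
    {a b p : ℤ} (hA : HasChainEulerChar A a) (hB : HasChainEulerChar B b)
    (hP : HasChainEulerChar P p) : HasChainEulerChar C (a + b - p) := by
  have commA : ∀ i j (x : A.X i), (C.d i j).hom ((fA.f i).hom x) =
      (fA.f j).hom ((A.d i j).hom x) := fun i j x =>
    congrArg (fun f => f.hom x) (fA.comm i j)
  have commB : ∀ i j (x : B.X i), (C.d i j).hom ((fB.f i).hom x) =
      (fB.f j).hom ((B.d i j).hom x) := fun i j x =>
    congrArg (fun f => f.hom x) (fB.comm i j)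
  let M : ∀ i, Submodule ℚ (C.X i) := fun i =>
    LinearMap.range (fA.f i).hom ⊔ LinearMap.range (fB.f i).hom
  have hM : ∀ i j, M i ≤ (M j).comap (C.d i j).hom := by
    intro i j
    refine sup_le ?_ ?_
    · rintro _ ⟨x, rfl⟩
      rw [Submodule.mem_comap, commA]
      exact Submodule.mem_sup_left ⟨_, rfl⟩
    · rintro _ ⟨x, rfl⟩
      rw [Submodule.mem_comap, commB]
      exact Submodule.mem_sup_right ⟨_, rfl⟩
  refine HasChainEulerChar.of_subChainComplex M hM hsmall ?_
  -- The short exact sequence `0 → P → A ⊕ B → A + B → 0`.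
  let φ : ∀ i, (A.X i × B.X i) →ₗ[ℚ] M i := fun i =>
    ((fA.f i).hom.coprod (-(fB.f i).hom)).codRestrict (M i) fun x =>
      (M i).add_mem (Submodule.mem_sup_left ⟨_, rfl⟩)
        (Submodule.neg_mem _ (Submodule.mem_sup_right ⟨_, rfl⟩))
  have hφ : ∀ i x, ((φ i x : M i) : C.X i) = (fA.f i).hom x.1 - (fB.f i).hom x.2 := fun i x =>
    (sub_eq_add_neg _ _).symm
  have comm' : ∀ i (x : P.X i), (fA.f i).hom ((iA.f i).hom x) = (fB.f i).hom ((iB.f i).hom x) :=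
    fun i x => congrArg (fun f => (f.f i).hom x) comm
  let S : ShortComplex (ChainComplex (ModuleCat.{0} ℚ) ℕ) :=
    { X₁ := P
      X₂ := prodChainComplex A B
      X₃ := subChainComplex C M hM
      f := { f := fun i => ModuleCat.ofHom ((iA.f i).hom.prod (iB.f i).hom)
             comm' := fun i j _ => by
              ext x
              exact Prod.ext (congrArg (fun f => f.hom x) (iA.comm i j))
                (congrArg (fun f => f.hom x) (iB.comm i j)) }
      g := { f := fun i => ModuleCat.ofHom (φ i)
             comm' := fun i j _ => by
              apply ModuleCat.hom_ext
              refine LinearMap.ext fun (x : A.X i × B.X i) => Subtype.ext ?_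
              change (C.d i j).hom ((φ i x : M i) : C.X i) =
                ((φ j ((A.d i j).hom x.1, (B.d i j).hom x.2) : M j) : C.X j)
              rw [hφ, hφ, map_sub, commA, commB] }
      zero := by
        ext i x
        apply Subtype.ext
        change ((φ i ((iA.f i).hom x, (iB.f i).hom x) : M i) : C.X i) = 0
        rw [hφ, comm', sub_self] }
  have hS : S.ShortExact := by
    refine shortExact_of_injective_exact_surjective (fun i x y h => hiA i (Prod.ext_iff.mp h).1)
      (fun i (x : A.X i × B.X i) => ⟨fun h => ?_, ?_⟩) fun i x => ?_
    · have h0 : ((φ i x : M i) : C.X i) = 0 := congrArg Subtype.val h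
      rw [hφ, sub_eq_zero] at h0
      obtain ⟨p, h1, h2⟩ := hpull i _ _ h0
      exact ⟨p, Prod.ext h1 h2⟩
    · rintro ⟨p, rfl⟩
      apply Subtype.ext
      change ((φ i ((iA.f i).hom p, (iB.f i).hom p) : M i) : C.X i) = 0
      rw [hφ, comm', sub_self]
    · obtain ⟨_, ⟨y, rfl⟩, _, ⟨z, rfl⟩, hx⟩ := Submodule.mem_sup.mp x.2
      refine ⟨(y, -z), Subtype.ext ?_⟩
      change ((φ i (y, -z) : M i) : C.X i) = _
      rw [hφ, ← hx, map_neg, sub_neg_eq_add]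
  exact HasChainEulerChar.right hS hP (hA.prod hB)

/-! ### Affine simplices -/

section AffineSimplices

/-- The affine map from the simplex with `k` vertices to the simplex with `m` vertices which sends
the `i`-th vertex to `p i`. -/
def affineSimplex {k m : ℕ} (p : Fin k → stdSimplex ℝ (Fin m)) :
    C(stdSimplex ℝ (Fin k), stdSimplex ℝ (Fin m)) where
  toFun x := ⟨fun j => ∑ i, x i * p i j, by
    refine ⟨fun j => Finset.sum_nonneg fun i _ => mul_nonneg (x.2.1 i) ((p i).2.1 j), ?_⟩
    rw [Finset.sum_comm]
    have h : ∀ i, ∑ j, p i j = 1 := fun i => (p i).2.2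
    simp_rw [← Finset.mul_sum, h, mul_one]
    exact x.2.2⟩
  continuous_toFun := by
    refine Continuous.subtype_mk (continuous_pi fun j => continuous_finsetSum _ fun i _ => ?_) _
    exact ((continuous_apply i).comp continuous_subtype_val).mul continuous_const

lemma affineSimplex_apply {k m : ℕ} (p : Fin k → stdSimplex ℝ (Fin m))
    (x : stdSimplex ℝ (Fin k)) (j : Fin m) : affineSimplex p x j = ∑ i, x i * p i j := rfl

lemma affineSimplex_coe {k m : ℕ} (p : Fin k → stdSimplex ℝ (Fin m))
    (x : stdSimplex ℝ (Fin k)) :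
    (affineSimplex p x : Fin m → ℝ) = ∑ i, x i • (p i : Fin m → ℝ) := by
  ext j
  simp only [Finset.sum_apply, Pi.smul_apply, smul_eq_mul]
  rfl

lemma affineSimplex_affineSimplex {k l m : ℕ} (p : Fin l → stdSimplex ℝ (Fin m))
    (q : Fin k → stdSimplex ℝ (Fin l)) (x : stdSimplex ℝ (Fin k)) :
    affineSimplex p (affineSimplex q x) = affineSimplex (fun i => affineSimplex p (q i)) x := by
  ext j
  simp only [affineSimplex_apply, Finset.sum_mul, Finset.mul_sum]
  rw [Finset.sum_comm]
  simp only [mul_assoc]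

lemma affineSimplex_vertex (k : ℕ) :
    affineSimplex (stdSimplex.vertex (S := ℝ) : Fin k → stdSimplex ℝ (Fin k)) =
      ContinuousMap.id _ := by
  ext x j
  rw [affineSimplex_apply]
  simp [Pi.single_apply]

lemma affineSimplex_apply_vertex {k m : ℕ} (p : Fin k → stdSimplex ℝ (Fin m)) (i : Fin k) :
    affineSimplex p (stdSimplex.vertex i) = p i := by
  ext j
  rw [affineSimplex_apply]
  simp [Pi.single_apply]

/-- The inclusion of the `i`-th face of the simplex with `k + 1` vertices. -/
noncomputable def faceInclusion {k : ℕ} (i : Fin (k + 1)) :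
    C(stdSimplex ℝ (Fin k), stdSimplex ℝ (Fin (k + 1))) :=
  ⟨stdSimplex.map i.succAbove, stdSimplex.continuous_map _⟩

lemma faceInclusion_eq {k : ℕ} (i : Fin (k + 1)) :
    faceInclusion i = affineSimplex fun j => stdSimplex.vertex (i.succAbove j) := by
  ext x j
  rw [affineSimplex_apply]
  change stdSimplex.map i.succAbove x j = _
  simp [FunOnFinite.linearMap_apply_apply, Pi.single_apply, Finset.sum_filter, eq_comm]

lemma affineSimplex_comp_faceInclusion {k m : ℕ} (p : Fin (k + 1) → stdSimplex ℝ (Fin m))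
    (i : Fin (k + 1)) :
    (affineSimplex p).comp (faceInclusion i) = affineSimplex (p ∘ i.succAbove) := by
  ext1 x
  rw [faceInclusion_eq, ContinuousMap.comp_apply, affineSimplex_affineSimplex]
  congr 2
  ext1 j
  exact affineSimplex_apply_vertex p _

/-- The barycenter of a nonempty tuple of points of a simplex. -/
noncomputable def tupleBarycenter {k m : ℕ} (p : Fin (k + 1) → stdSimplex ℝ (Fin m)) :
    stdSimplex ℝ (Fin m) :=
  affineSimplex p stdSimplex.barycenter

end AffineSimplices

/-! ### Chains of tuples -/

section TupleChains

/-- Rational linear combinations of `k`-tuples of points of `E`. A tuple stands for the possibly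
degenerate affine simplex with these vertices; `k = 0` is the augmentation degree. -/
abbrev TupleChain (E : Type*) (k : ℕ) : Type _ := (Fin k → E) →₀ ℚ

variable {E F : Type*}

/-- The augmented boundary operator on tuples. -/
noncomputable def tupleBoundary (k : ℕ) : TupleChain E (k + 1) →ₗ[ℚ] TupleChain E k :=
  Finsupp.linearCombination ℚ fun p =>
    ∑ i : Fin (k + 1), (-1 : ℚ) ^ (i : ℕ) • Finsupp.single (p ∘ i.succAbove) 1

lemma tupleBoundary_single {k : ℕ} (p : Fin (k + 1) → E) :
    tupleBoundary k (Finsupp.single p 1) =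
      ∑ i : Fin (k + 1), (-1 : ℚ) ^ (i : ℕ) • Finsupp.single (p ∘ i.succAbove) (1 : ℚ) := by
  simp [tupleBoundary]

/-- The cone with apex `b`. -/
noncomputable def tupleCone (b : E) (k : ℕ) : TupleChain E k →ₗ[ℚ] TupleChain E (k + 1) :=
  Finsupp.lmapDomain ℚ ℚ fun p => Fin.cons b p

lemma tupleCone_single (b : E) {k : ℕ} (p : Fin k → E) (a : ℚ) :
    tupleCone b k (Finsupp.single p a) = Finsupp.single (Fin.cons b p : Fin (k + 1) → E) a := by
  simp [tupleCone]

lemma tupleBoundary_tupleCone_zero (b : E) (c : TupleChain E 0) :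
    tupleBoundary 0 (tupleCone b 0 c) = c := by
  induction c using Finsupp.induction_linear with
  | zero => simp
  | add x y hx hy => rw [map_add, map_add, hx, hy]
  | single p a =>
    rw [← mul_one a, ← smul_eq_mul, ← Finsupp.smul_single, map_smul, map_smul, tupleCone_single,
      tupleBoundary_single]
    simp [Subsingleton.elim ((Fin.cons b p : Fin 1 → E) ∘ Fin.succ) p]

lemma tupleBoundary_tupleCone (b : E) {k : ℕ} (c : TupleChain E (k + 1)) :
    tupleBoundary (k + 1) (tupleCone b (k + 1) c) =
      c - tupleCone b k (tupleBoundary k c) := by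
  induction c using Finsupp.induction_linear with
  | zero => simp
  | add x y hx hy => simp only [map_add, hx, hy]; abel
  | single p a =>
    rw [← mul_one a, ← smul_eq_mul, ← Finsupp.smul_single, map_smul, map_smul, map_smul, map_smul,
      ← smul_sub]
    congr 1
    rw [tupleCone_single, tupleBoundary_single, tupleBoundary_single, Fin.sum_univ_succ, map_sum,
      sub_eq_add_neg, ← Finset.sum_neg_distrib]
    congr 1
    · simp only [Fin.val_zero, pow_zero, one_smul]
      congr 1
    · refine Finset.sum_congr rfl fun i _ => ?_
      rw [map_smul, tupleCone_single, Fin.val_succ, pow_succ, mul_neg_one, neg_smul]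
      congr 3
      ext j
      refine Fin.cases ?_ (fun j => ?_) j <;> simp

lemma tupleBoundary_tupleBoundary (k : ℕ) (c : TupleChain E (k + 2)) :
    tupleBoundary k (tupleBoundary (k + 1) c) = 0 := by
  induction k with
  | zero =>
    induction c using Finsupp.induction_linear with
    | zero => simp
    | add x y hx hy => simp only [map_add, hx, hy, add_zero]
    | single p a =>
      have : Finsupp.single p a = tupleCone (p 0) 1 (Finsupp.single (Fin.tail p) a) := by
        rw [tupleCone_single, Fin.cons_self_tail]
      rw [this, tupleBoundary_tupleCone, map_sub, tupleBoundary_tupleCone_zero, sub_self]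
  | succ k ih =>
    induction c using Finsupp.induction_linear with
    | zero => simp
    | add x y hx hy => simp only [map_add, hx, hy, add_zero]
    | single p a =>
      have : Finsupp.single p a = tupleCone (p 0) (k + 2) (Finsupp.single (Fin.tail p) a) := by
        rw [tupleCone_single, Fin.cons_self_tail]
      rw [this, tupleBoundary_tupleCone, map_sub, tupleBoundary_tupleCone, ih, map_zero, sub_zero,
        sub_self]

/-- The pushforward of tuples along a map. -/
noncomputable def tuplePush (f : E → F) (k : ℕ) : TupleChain E k →ₗ[ℚ] TupleChain F k :=
  Finsupp.lmapDomain ℚ ℚ fun p => f ∘ p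

lemma tuplePush_single (f : E → F) {k : ℕ} (p : Fin k → E) (a : ℚ) :
    tuplePush f k (Finsupp.single p a) = Finsupp.single (f ∘ p) a := by
  simp [tuplePush]

lemma tuplePush_tupleBoundary (f : E → F) {k : ℕ} (c : TupleChain E (k + 1)) :
    tuplePush f k (tupleBoundary k c) = tupleBoundary k (tuplePush f (k + 1) c) := by
  revert c
  refine LinearMap.congr_fun (f := tuplePush f k ∘ₗ tupleBoundary k)
    (g := tupleBoundary k ∘ₗ tuplePush f (k + 1)) ?_
  refine Finsupp.lhom_ext' fun p => LinearMap.ext_ring ?_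
  simp only [LinearMap.comp_apply, Finsupp.lsingle_apply, tuplePush_single, tupleBoundary_single,
    map_sum, map_smul]
  rfl

lemma tuplePush_tupleCone (f : E → F) (b : E) {k : ℕ} (c : TupleChain E k) :
    tuplePush f (k + 1) (tupleCone b k c) = tupleCone (f b) k (tuplePush f k c) := by
  revert c
  refine LinearMap.congr_fun (f := tuplePush f (k + 1) ∘ₗ tupleCone b k)
    (g := tupleCone (f b) k ∘ₗ tuplePush f k) ?_
  refine Finsupp.lhom_ext' fun p => LinearMap.ext_ring ?_
  simp only [LinearMap.comp_apply, Finsupp.lsingle_apply, tuplePush_single, tupleCone_single]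
  congr 1
  ext j
  refine Fin.cases ?_ (fun j => ?_) j <;> simp

end TupleChains

/-! ### Barycentric subdivision -/

section Subdivision

variable {m n : ℕ}

/-- Barycentric subdivision of affine simplices in a simplex: the cone, with the barycenter as apex,
over the subdivision of the boundary. -/
noncomputable def tupleSubdivision :
    ∀ k : ℕ, TupleChain (stdSimplex ℝ (Fin m)) k →ₗ[ℚ] TupleChain (stdSimplex ℝ (Fin m)) k
  | 0 => LinearMap.id
  | k + 1 => Finsupp.linearCombination ℚ fun p =>
      tupleCone (tupleBarycenter p) k (tupleSubdivision k (tupleBoundary k (Finsupp.single p 1)))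

/-- The chain homotopy between the identity and barycentric subdivision. -/
noncomputable def tupleHomotopy :
    ∀ k : ℕ, TupleChain (stdSimplex ℝ (Fin m)) k →ₗ[ℚ] TupleChain (stdSimplex ℝ (Fin m)) (k + 1)
  | 0 => 0
  | k + 1 => Finsupp.linearCombination ℚ fun p =>
      tupleCone (tupleBarycenter p) (k + 1)
        (Finsupp.single p 1 - tupleHomotopy k (tupleBoundary k (Finsupp.single p 1)))

lemma tupleSubdivision_single {k : ℕ} (p : Fin (k + 1) → stdSimplex ℝ (Fin m)) :
    tupleSubdivision (k + 1) (Finsupp.single p 1) =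
      tupleCone (tupleBarycenter p) k
        (tupleSubdivision k (tupleBoundary k (Finsupp.single p 1))) := by
  simp [tupleSubdivision]

lemma tupleHomotopy_single {k : ℕ} (p : Fin (k + 1) → stdSimplex ℝ (Fin m)) :
    tupleHomotopy (k + 1) (Finsupp.single p 1) =
      tupleCone (tupleBarycenter p) (k + 1)
        (Finsupp.single p 1 - tupleHomotopy k (tupleBoundary k (Finsupp.single p 1))) := by
  simp [tupleHomotopy]

lemma tupleBoundary_tupleSubdivision {k : ℕ} (c : TupleChain (stdSimplex ℝ (Fin m)) (k + 1)) :
    tupleBoundary k (tupleSubdivision (k + 1) c) = tupleSubdivision k (tupleBoundary k c) := by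
  induction k with
  | zero =>
    revert c
    refine LinearMap.congr_fun (f := tupleBoundary 0 ∘ₗ tupleSubdivision 1)
      (g := tupleSubdivision 0 ∘ₗ tupleBoundary 0) ?_
    refine Finsupp.lhom_ext' fun p => LinearMap.ext_ring ?_
    simp only [LinearMap.comp_apply, Finsupp.lsingle_apply]
    rw [tupleSubdivision_single, tupleBoundary_tupleCone_zero]
  | succ k ih =>
    revert c
    refine LinearMap.congr_fun (f := tupleBoundary (k + 1) ∘ₗ tupleSubdivision (k + 2))
      (g := tupleSubdivision (k + 1) ∘ₗ tupleBoundary (k + 1)) ?_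
    refine Finsupp.lhom_ext' fun p => LinearMap.ext_ring ?_
    simp only [LinearMap.comp_apply, Finsupp.lsingle_apply]
    rw [tupleSubdivision_single, tupleBoundary_tupleCone, ih, tupleBoundary_tupleBoundary,
      map_zero, map_zero, sub_zero]

lemma tupleBoundary_tupleHomotopy {k : ℕ} (c : TupleChain (stdSimplex ℝ (Fin m)) (k + 1)) :
    tupleBoundary (k + 1) (tupleHomotopy (k + 1) c) =
      c - tupleSubdivision (k + 1) c - tupleHomotopy k (tupleBoundary k c) := by
  induction k with
  | zero =>
    revert c
    refine LinearMap.congr_fun (f := tupleBoundary 1 ∘ₗ tupleHomotopy 1)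
      (g := LinearMap.id - tupleSubdivision 1 - tupleHomotopy 0 ∘ₗ tupleBoundary 0) ?_
    refine Finsupp.lhom_ext' fun p => LinearMap.ext_ring ?_
    simp only [LinearMap.comp_apply, Finsupp.lsingle_apply, LinearMap.sub_apply,
      LinearMap.id_apply]
    rw [tupleHomotopy_single, tupleBoundary_tupleCone, tupleSubdivision_single]
    simp [tupleHomotopy, tupleSubdivision]
  | succ k ih =>
    revert c
    refine LinearMap.congr_fun (f := tupleBoundary (k + 2) ∘ₗ tupleHomotopy (k + 2))
      (g := LinearMap.id - tupleSubdivision (k + 2) - tupleHomotopy (k + 1) ∘ₗ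
        tupleBoundary (k + 1)) ?_
    refine Finsupp.lhom_ext' fun p => LinearMap.ext_ring ?_
    simp only [LinearMap.comp_apply, Finsupp.lsingle_apply, LinearMap.sub_apply,
      LinearMap.id_apply]
    rw [tupleHomotopy_single, tupleBoundary_tupleCone, tupleSubdivision_single, map_sub, ih,
      tupleBoundary_tupleBoundary]
    simp only [map_zero, sub_zero, sub_sub_cancel]
    abel

lemma tupleBarycenter_comp {k : ℕ} (q : Fin m → stdSimplex ℝ (Fin n))
    (p : Fin (k + 1) → stdSimplex ℝ (Fin m)) :
    tupleBarycenter (affineSimplex q ∘ p) = affineSimplex q (tupleBarycenter p) :=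
  (affineSimplex_affineSimplex q p _).symm

/-- Subdivision is natural for affine maps, which makes it well defined on singular chains. -/
lemma tuplePush_tupleSubdivision (q : Fin m → stdSimplex ℝ (Fin n)) {k : ℕ}
    (c : TupleChain (stdSimplex ℝ (Fin m)) k) :
    tuplePush (affineSimplex q) k (tupleSubdivision k c) =
      tupleSubdivision k (tuplePush (affineSimplex q) k c) := by
  induction k with
  | zero => rfl
  | succ k ih =>
    revert c
    refine LinearMap.congr_fun (f := tuplePush (affineSimplex q) (k + 1) ∘ₗ
      tupleSubdivision (k + 1)) (g := tupleSubdivision (k + 1) ∘ₗ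
      tuplePush (affineSimplex q) (k + 1)) ?_
    refine Finsupp.lhom_ext' fun p => LinearMap.ext_ring ?_
    simp only [LinearMap.comp_apply, Finsupp.lsingle_apply]
    rw [tuplePush_single, tupleSubdivision_single, tupleSubdivision_single, tuplePush_tupleCone,
      ih, tuplePush_tupleBoundary, tuplePush_single, tupleBarycenter_comp]

lemma tuplePush_tupleHomotopy (q : Fin m → stdSimplex ℝ (Fin n)) {k : ℕ}
    (c : TupleChain (stdSimplex ℝ (Fin m)) k) :
    tuplePush (affineSimplex q) (k + 1) (tupleHomotopy k c) =
      tupleHomotopy k (tuplePush (affineSimplex q) k c) := by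
  induction k with
  | zero => simp [tupleHomotopy]
  | succ k ih =>
    revert c
    refine LinearMap.congr_fun (f := tuplePush (affineSimplex q) (k + 2) ∘ₗ
      tupleHomotopy (k + 1)) (g := tupleHomotopy (k + 1) ∘ₗ
      tuplePush (affineSimplex q) (k + 1)) ?_
    refine Finsupp.lhom_ext' fun p => LinearMap.ext_ring ?_
    simp only [LinearMap.comp_apply, Finsupp.lsingle_apply]
    rw [tuplePush_single, tupleHomotopy_single, tupleHomotopy_single, tuplePush_tupleCone,
      map_sub, ih, tuplePush_tupleBoundary, tuplePush_single, tupleBarycenter_comp]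

end Subdivision

/-! ### The mesh of barycentric subdivisions -/

section Mesh

variable {m : ℕ}

lemma affineSimplex_mem_of_convex {k : ℕ} {p : Fin k → stdSimplex ℝ (Fin m)}
    {s : Set (Fin m → ℝ)} (hs : Convex ℝ s) (hp : ∀ i, (p i : Fin m → ℝ) ∈ s)
    (x : stdSimplex ℝ (Fin k)) : (affineSimplex p x : Fin m → ℝ) ∈ s := by
  rw [affineSimplex_coe]
  exact hs.sum_mem (fun i _ => x.2.1 i) x.2.2 fun i _ => hp i

/-- A vertex of a simplex with at most `N` vertices and of diameter at most `r` has distance at most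
`(1 - 1 / N) * r` from the barycenter. -/
lemma dist_tupleBarycenter_le {k N : ℕ} (hkN : k + 1 ≤ N) {p : Fin (k + 1) → stdSimplex ℝ (Fin m)}
    {r : ℝ} (hp : ∀ i j, dist (p i) (p j) ≤ r) (j : Fin (k + 1)) :
    dist (p j) (tupleBarycenter p) ≤ (1 - 1 / N) * r := by
  have hr : 0 ≤ r := dist_nonneg.trans (hp 0 0)
  have hk : (0 : ℝ) < k + 1 := by positivity
  have hb : (tupleBarycenter p : Fin m → ℝ) - p j =
      ∑ i ∈ Finset.univ.erase j, (1 / (k + 1 : ℝ)) • ((p i : Fin m → ℝ) - p j) := by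
    have h0 : ∑ i ∈ Finset.univ.erase j, (1 / (k + 1 : ℝ)) • ((p i : Fin m → ℝ) - p j) =
        ∑ i, (1 / (k + 1 : ℝ)) • ((p i : Fin m → ℝ) - p j) :=
      Finset.sum_erase _ (by simp)
    rw [h0, tupleBarycenter, affineSimplex_coe]
    simp only [smul_sub, Finset.sum_sub_distrib, Finset.sum_const, Finset.card_univ,
      Fintype.card_fin]
    congr 1
    · refine Finset.sum_congr rfl fun i _ => ?_
      congr 1
      refine (stdSimplex.barycenter_apply (𝕜 := ℝ) i).trans ?_
      rw [Fintype.card_fin, one_div]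
      push_cast
      rfl
    · rw [← Nat.cast_smul_eq_nsmul ℝ, smul_smul]
      push_cast
      rw [mul_one_div_cancel hk.ne', one_smul]
  rw [dist_comm, Subtype.dist_eq, dist_eq_norm]
  change ‖(tupleBarycenter p : Fin m → ℝ) - p j‖ ≤ _
  rw [hb]
  refine (norm_sum_le _ _).trans ?_
  have hterm : ∀ i ∈ Finset.univ.erase j,
      ‖(1 / (k + 1 : ℝ)) • ((p i : Fin m → ℝ) - p j)‖ ≤ 1 / (k + 1 : ℝ) * r := by
    intro i _
    rw [norm_smul, Real.norm_of_nonneg (by positivity), ← dist_eq_norm]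
    exact mul_le_mul_of_nonneg_left (hp i j) (by positivity)
  refine (Finset.sum_le_card_nsmul _ _ _ hterm).trans ?_
  rw [Finset.card_erase_of_mem (Finset.mem_univ j), Finset.card_univ, Fintype.card_fin,
    nsmul_eq_mul, ← mul_assoc]
  refine mul_le_mul_of_nonneg_right ?_ hr
  have hN : (k + 1 : ℝ) ≤ N := by exact_mod_cast hkN
  have : 1 / (N : ℝ) ≤ 1 / (k + 1 : ℝ) := one_div_le_one_div_of_le hk hN
  have h2 : ((k + 1 - 1 : ℕ) : ℝ) * (1 / (k + 1 : ℝ)) = 1 - 1 / (k + 1 : ℝ) := by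
    simp
    field_simp
    ring
  rw [h2]
  linarith

/-- Barycentric subdivision of a simplex with at most `N` vertices shrinks mutual distances of
vertices by the factor `1 - 1 / N` and stays in the convex hull of the vertices. -/
lemma tupleSubdivision_single_mem_supported {N : ℕ} {r : ℝ} (k : ℕ) (hkN : k ≤ N)
    (p : Fin k → stdSimplex ℝ (Fin m)) (hp : ∀ i j, dist (p i) (p j) ≤ r) :
    tupleSubdivision k (Finsupp.single p 1) ∈ Finsupp.supported ℚ ℚ
      {q : Fin k → stdSimplex ℝ (Fin m) |
        (∀ i, (q i : Fin m → ℝ) ∈ convexHull ℝ (Set.range fun j => (p j : Fin m → ℝ))) ∧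
        ∀ i j, dist (q i) (q j) ≤ (1 - 1 / N) * r} := by
  induction k with
  | zero =>
    refine Finsupp.single_mem_supported ℚ _ ⟨fun i => i.elim0, fun i => i.elim0⟩
  | succ k ih =>
    rw [tupleSubdivision_single, tupleBoundary_single, map_sum, map_sum]
    refine Submodule.sum_mem _ fun i _ => ?_
    rw [map_smul, map_smul]
    refine Submodule.smul_mem _ _ ?_
    have hsub := ih (by omega) (p ∘ i.succAbove) fun a b => hp _ _
    have hr : 0 ≤ r := dist_nonneg.trans (hp 0 0)
    have hρ : 0 ≤ (1 - 1 / (N : ℝ)) * r := dist_nonneg.trans (dist_tupleBarycenter_le hkN hp 0)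
    rw [tupleCone, Finsupp.lmapDomain_apply]
    rw [Finsupp.mem_supported] at hsub ⊢
    intro q' hq'
    obtain ⟨q, hq, rfl⟩ := Finset.mem_image.mp (Finsupp.mapDomain_support hq')
    obtain ⟨hq1, hq2⟩ := hsub hq
    have hq1' : ∀ i, (q i : Fin m → ℝ) ∈ convexHull ℝ (Set.range fun j => (p j : Fin m → ℝ)) := by
      intro a
      refine convexHull_mono ?_ (hq1 a)
      rintro _ ⟨b, rfl⟩
      exact ⟨_, rfl⟩
    have hqb : ∀ a, dist (q a) (tupleBarycenter p) ≤ (1 - 1 / N) * r := by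
      intro a
      have : convexHull ℝ (Set.range fun j => (p j : Fin m → ℝ)) ⊆
          Metric.closedBall (tupleBarycenter p : Fin m → ℝ) ((1 - 1 / N) * r) := by
        refine convexHull_min ?_ (convex_closedBall _ _)
        rintro _ ⟨b, rfl⟩
        exact dist_tupleBarycenter_le hkN hp b
      exact this (hq1' a)
    refine ⟨fun a => ?_, fun a b => ?_⟩
    · refine Fin.cases ?_ (fun a => ?_) a
      · rw [Fin.cons_zero]
        exact affineSimplex_mem_of_convex (convex_convexHull ℝ _)
          (fun i => subset_convexHull ℝ _ (Set.mem_range_self i)) _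
      · rw [Fin.cons_succ]
        exact hq1' a
    · refine Fin.cases ?_ (fun a => ?_) a <;> refine Fin.cases ?_ (fun b => ?_) b
      · rw [dist_self]
        exact hρ
      · rw [Fin.cons_succ, Fin.cons_zero, dist_comm]
        exact hqb b
      · rw [Fin.cons_succ, Fin.cons_zero]
        exact hqb a
      · rw [Fin.cons_succ, Fin.cons_succ]
        exact hq2 a b

lemma linearMap_mem_of_mem_supported {α M : Type*} [AddCommGroup M] [Module ℚ M]
    (f : (α →₀ ℚ) →ₗ[ℚ] M) {s : Set α} {N : Submodule ℚ M}
    (h : ∀ a ∈ s, f (Finsupp.single a 1) ∈ N) {c : α →₀ ℚ} (hc : c ∈ Finsupp.supported ℚ ℚ s) :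
    f c ∈ N := by
  rw [Finsupp.supported_eq_span_single] at hc
  have : Submodule.span ℚ ((fun i => Finsupp.single i (1 : ℚ)) '' s) ≤ N.comap f := by
    rw [Submodule.span_le]
    rintro _ ⟨a, ha, rfl⟩
    exact h a ha
  exact this hc

lemma tupleSubdivision_iterate_vertex_mem_supported (k n : ℕ) :
    (tupleSubdivision k)^[n] (Finsupp.single (stdSimplex.vertex (S := ℝ)) 1) ∈
      Finsupp.supported ℚ ℚ
      {q : Fin k → stdSimplex ℝ (Fin k) | ∀ i j, dist (q i) (q j) ≤ (1 - 1 / k) ^ n} := by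
  induction n with
  | zero =>
    refine Finsupp.single_mem_supported ℚ _ fun i j => ?_
    rw [pow_zero, Subtype.dist_eq]
    exact (Metric.dist_le_diam_of_mem (bounded_stdSimplex (Fin k)) (Subtype.property _)
      (Subtype.property _)).trans diam_stdSimplex_le
  | succ n ih =>
    rw [Function.iterate_succ_apply']
    refine linearMap_mem_of_mem_supported _ (fun q hq => ?_) ih
    refine Finsupp.supported_mono ?_ (tupleSubdivision_single_mem_supported k le_rfl q hq)
    intro q' hq' i j
    rw [pow_succ']
    exact hq'.2 i j

end Mesh

/-! ### Small singular simplices -/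

section SimplexChains

variable {X : Type*} [TopologicalSpace X]

variable (X) in
/-- Rational linear combinations of singular simplices with `k` vertices in `X`. They have degree
`k - 1` in the singular chain complex. -/
abbrev SimplexChain (k : ℕ) : Type _ := C(stdSimplex ℝ (Fin k), X) →₀ ℚ

/-- The boundary operator on singular chains. -/
noncomputable def simplexBoundary (k : ℕ) : SimplexChain X (k + 1) →ₗ[ℚ] SimplexChain X k :=
  Finsupp.linearCombination ℚ fun σ =>
    ∑ i : Fin (k + 1), (-1 : ℚ) ^ (i : ℕ) • Finsupp.single (σ.comp (faceInclusion i)) 1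

lemma simplexBoundary_single {k : ℕ} (σ : C(stdSimplex ℝ (Fin (k + 1)), X)) :
    simplexBoundary k (Finsupp.single σ 1) =
      ∑ i : Fin (k + 1), (-1 : ℚ) ^ (i : ℕ) •
        Finsupp.single (σ.comp (faceInclusion i)) (1 : ℚ) := by
  simp [simplexBoundary]

/-- Restriction of a singular simplex `σ` to affine simplices in its domain. -/
noncomputable def simplexRestrict {m : ℕ} (σ : C(stdSimplex ℝ (Fin m), X)) (k : ℕ) :
    TupleChain (stdSimplex ℝ (Fin m)) k →ₗ[ℚ] SimplexChain X k :=
  Finsupp.lmapDomain ℚ ℚ fun p => σ.comp (affineSimplex p)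

lemma simplexRestrict_single {m k : ℕ} (σ : C(stdSimplex ℝ (Fin m), X))
    (p : Fin k → stdSimplex ℝ (Fin m)) (a : ℚ) :
    simplexRestrict σ k (Finsupp.single p a) = Finsupp.single (σ.comp (affineSimplex p)) a := by
  simp [simplexRestrict]

lemma simplexRestrict_vertex {k : ℕ} (σ : C(stdSimplex ℝ (Fin k), X)) :
    simplexRestrict σ k (Finsupp.single (stdSimplex.vertex (S := ℝ)) 1) = Finsupp.single σ 1 := by
  rw [simplexRestrict_single, affineSimplex_vertex, ContinuousMap.comp_id]

lemma simplexBoundary_simplexRestrict {m k : ℕ} (σ : C(stdSimplex ℝ (Fin m), X))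
    (c : TupleChain (stdSimplex ℝ (Fin m)) (k + 1)) :
    simplexBoundary k (simplexRestrict σ (k + 1) c) =
      simplexRestrict σ k (tupleBoundary k c) := by
  revert c
  refine LinearMap.congr_fun (f := simplexBoundary k ∘ₗ simplexRestrict σ (k + 1))
    (g := simplexRestrict σ k ∘ₗ tupleBoundary k) ?_
  refine Finsupp.lhom_ext' fun p => LinearMap.ext_ring ?_
  simp only [LinearMap.comp_apply, Finsupp.lsingle_apply, simplexRestrict_single,
    tupleBoundary_single, simplexBoundary_single, map_sum, map_smul, ContinuousMap.comp_assoc,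
    affineSimplex_comp_faceInclusion]

lemma simplexRestrict_comp {l m k : ℕ} (σ : C(stdSimplex ℝ (Fin m), X))
    (q : Fin l → stdSimplex ℝ (Fin m)) (c : TupleChain (stdSimplex ℝ (Fin l)) k) :
    simplexRestrict (σ.comp (affineSimplex q)) k c =
      simplexRestrict σ k (tuplePush (affineSimplex q) k c) := by
  revert c
  refine LinearMap.congr_fun (f := simplexRestrict (σ.comp (affineSimplex q)) k)
    (g := simplexRestrict σ k ∘ₗ tuplePush (affineSimplex q) k) ?_
  refine Finsupp.lhom_ext' fun p => LinearMap.ext_ring ?_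
  simp only [LinearMap.comp_apply, Finsupp.lsingle_apply, simplexRestrict_single,
    tuplePush_single]
  congr 1
  ext1 x
  exact congrArg σ (affineSimplex_affineSimplex q p x)

/-- Barycentric subdivision of singular chains. -/
noncomputable def simplexSubdivision (k : ℕ) : SimplexChain X k →ₗ[ℚ] SimplexChain X k :=
  Finsupp.linearCombination ℚ fun σ => simplexRestrict σ k
    (tupleSubdivision k (Finsupp.single (stdSimplex.vertex (S := ℝ)) 1))

/-- The chain homotopy between the identity and barycentric subdivision of singular chains. -/
noncomputable def simplexHomotopy (k : ℕ) : SimplexChain X k →ₗ[ℚ] SimplexChain X (k + 1) :=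
  Finsupp.linearCombination ℚ fun σ => simplexRestrict σ (k + 1)
    (tupleHomotopy k (Finsupp.single (stdSimplex.vertex (S := ℝ)) 1))

lemma tuplePush_vertex {k m : ℕ} (p : Fin k → stdSimplex ℝ (Fin m)) :
    tuplePush (affineSimplex p) k (Finsupp.single (stdSimplex.vertex (S := ℝ)) 1) =
      Finsupp.single p 1 := by
  rw [tuplePush_single]
  congr 1
  ext1 i
  exact affineSimplex_apply_vertex p i

lemma simplexSubdivision_simplexRestrict {m k : ℕ} (σ : C(stdSimplex ℝ (Fin m), X))
    (c : TupleChain (stdSimplex ℝ (Fin m)) k) :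
    simplexSubdivision k (simplexRestrict σ k c) = simplexRestrict σ k (tupleSubdivision k c) := by
  revert c
  refine LinearMap.congr_fun (f := simplexSubdivision k ∘ₗ simplexRestrict σ k)
    (g := simplexRestrict σ k ∘ₗ tupleSubdivision k) ?_
  refine Finsupp.lhom_ext' fun p => LinearMap.ext_ring ?_
  simp only [LinearMap.comp_apply, Finsupp.lsingle_apply, simplexRestrict_single]
  rw [simplexSubdivision, Finsupp.linearCombination_single, one_smul, simplexRestrict_comp,
    tuplePush_tupleSubdivision, tuplePush_vertex]

lemma simplexHomotopy_simplexRestrict {m k : ℕ} (σ : C(stdSimplex ℝ (Fin m), X))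
    (c : TupleChain (stdSimplex ℝ (Fin m)) k) :
    simplexHomotopy k (simplexRestrict σ k c) =
      simplexRestrict σ (k + 1) (tupleHomotopy k c) := by
  revert c
  refine LinearMap.congr_fun (f := simplexHomotopy k ∘ₗ simplexRestrict σ k)
    (g := simplexRestrict σ (k + 1) ∘ₗ tupleHomotopy k) ?_
  refine Finsupp.lhom_ext' fun p => LinearMap.ext_ring ?_
  simp only [LinearMap.comp_apply, Finsupp.lsingle_apply, simplexRestrict_single]
  rw [simplexHomotopy, Finsupp.linearCombination_single, one_smul, simplexRestrict_comp,
    tuplePush_tupleHomotopy, tuplePush_vertex]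

lemma simplexBoundary_simplexSubdivision {k : ℕ} (c : SimplexChain X (k + 1)) :
    simplexBoundary k (simplexSubdivision (k + 1) c) =
      simplexSubdivision k (simplexBoundary k c) := by
  revert c
  refine LinearMap.congr_fun (f := simplexBoundary k ∘ₗ simplexSubdivision (k + 1))
    (g := simplexSubdivision k ∘ₗ simplexBoundary k) ?_
  refine Finsupp.lhom_ext' fun σ => LinearMap.ext_ring ?_
  simp only [LinearMap.comp_apply, Finsupp.lsingle_apply]
  rw [← simplexRestrict_vertex, simplexSubdivision_simplexRestrict,
    simplexBoundary_simplexRestrict, simplexBoundary_simplexRestrict,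
    simplexSubdivision_simplexRestrict, tupleBoundary_tupleSubdivision]

lemma simplexBoundary_simplexHomotopy {k : ℕ} (c : SimplexChain X (k + 1)) :
    simplexBoundary (k + 1) (simplexHomotopy (k + 1) c) =
      c - simplexSubdivision (k + 1) c - simplexHomotopy k (simplexBoundary k c) := by
  revert c
  refine LinearMap.congr_fun (f := simplexBoundary (k + 1) ∘ₗ simplexHomotopy (k + 1))
    (g := LinearMap.id - simplexSubdivision (X := X) (k + 1) - simplexHomotopy k ∘ₗ simplexBoundary k) ?_
  refine Finsupp.lhom_ext' fun σ => LinearMap.ext_ring ?_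
  simp only [LinearMap.comp_apply, Finsupp.lsingle_apply, LinearMap.sub_apply, LinearMap.id_apply]
  rw [← simplexRestrict_vertex, simplexSubdivision_simplexRestrict,
    simplexBoundary_simplexRestrict, simplexHomotopy_simplexRestrict,
    simplexHomotopy_simplexRestrict,
    simplexBoundary_simplexRestrict, tupleBoundary_tupleHomotopy, map_sub, map_sub]

/-- The chains made of singular simplices that lie in `U` or in `W`. -/
def smallChains (U W : Set X) (k : ℕ) : Submodule ℚ (SimplexChain X k) :=
  Finsupp.supported ℚ ℚ {σ : C(stdSimplex ℝ (Fin k), X) | Set.range σ ⊆ U ∨ Set.range σ ⊆ W}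

lemma simplexRestrict_mem_smallChains {U W : Set X} {m k : ℕ} {σ : C(stdSimplex ℝ (Fin m), X)}
    (hσ : Set.range σ ⊆ U ∨ Set.range σ ⊆ W) (c : TupleChain (stdSimplex ℝ (Fin m)) k) :
    simplexRestrict σ k c ∈ smallChains U W k := by
  have hc : c ∈ Finsupp.supported ℚ ℚ Set.univ := by simp
  refine linearMap_mem_of_mem_supported _ (fun p _ => ?_) hc
  rw [simplexRestrict_single]
  refine Finsupp.single_mem_supported ℚ _ ?_
  refine hσ.imp ?_ ?_ <;>
  · rintro h _ ⟨x, rfl⟩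
    exact h ⟨_, rfl⟩

lemma simplexSubdivision_mem_smallChains {U W : Set X} {k : ℕ} {c : SimplexChain X k}
    (hc : c ∈ smallChains U W k) : simplexSubdivision k c ∈ smallChains U W k := by
  refine linearMap_mem_of_mem_supported _ (fun σ hσ => ?_) hc
  rw [← simplexRestrict_vertex, simplexSubdivision_simplexRestrict]
  exact simplexRestrict_mem_smallChains hσ _

lemma simplexHomotopy_mem_smallChains {U W : Set X} {k : ℕ} {c : SimplexChain X k}
    (hc : c ∈ smallChains U W k) : simplexHomotopy k c ∈ smallChains U W (k + 1) := by
  refine linearMap_mem_of_mem_supported _ (fun σ hσ => ?_) hc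
  rw [← simplexRestrict_vertex, simplexHomotopy_simplexRestrict]
  exact simplexRestrict_mem_smallChains hσ _

lemma iterate_simplexSubdivision_mem_smallChains {U W : Set X} {k : ℕ} {c : SimplexChain X k}
    (hc : c ∈ smallChains U W k) (n : ℕ) : (simplexSubdivision k)^[n] c ∈ smallChains U W k := by
  induction n with
  | zero => exact hc
  | succ n ih =>
    rw [Function.iterate_succ_apply']
    exact simplexSubdivision_mem_smallChains ih

lemma iterate_simplexSubdivision_simplexRestrict {m k : ℕ} (σ : C(stdSimplex ℝ (Fin m), X))
    (c : TupleChain (stdSimplex ℝ (Fin m)) k) (n : ℕ) :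
    (simplexSubdivision k)^[n] (simplexRestrict σ k c) =
      simplexRestrict σ k ((tupleSubdivision k)^[n] c) := by
  induction n with
  | zero => rfl
  | succ n ih =>
    rw [Function.iterate_succ_apply', ih, simplexSubdivision_simplexRestrict,
      Function.iterate_succ_apply']

/-- By Lebesgue's number lemma, the simplices of a fine subdivision lie in one of the sets of an open
cover. -/
lemma iterate_simplexSubdivision_single_mem_smallChains {U W : Set X} (hU : IsOpen U)
    (hW : IsOpen W) (hUW : U ∪ W = Set.univ) {k : ℕ} (σ : C(stdSimplex ℝ (Fin (k + 1)), X)) :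
    ∃ n, (simplexSubdivision (k + 1))^[n] (Finsupp.single σ 1) ∈ smallChains U W (k + 1) := by
  obtain ⟨ε, hε, hball⟩ := lebesgue_number_lemma_of_metric
    (s := (Set.univ : Set (stdSimplex ℝ (Fin (k + 1))))) (c := fun b : Bool => σ ⁻¹' (cond b U W))
    isCompact_univ (fun b => (by cases b <;> simpa : IsOpen (cond b U W)).preimage σ.continuous)
    (fun x _ => by
      rcases hUW.ge (Set.mem_univ (σ x)) with h | h
      · exact Set.mem_iUnion.mpr ⟨true, h⟩
      · exact Set.mem_iUnion.mpr ⟨false, h⟩)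
  obtain ⟨n, hn⟩ := exists_pow_lt_of_lt_one hε
    (show (1 - 1 / ((k + 1 : ℕ) : ℝ)) < 1 from sub_lt_self _ (by positivity))
  refine ⟨n, ?_⟩
  rw [← simplexRestrict_vertex, iterate_simplexSubdivision_simplexRestrict]
  refine linearMap_mem_of_mem_supported _ (fun q hq => ?_)
    (tupleSubdivision_iterate_vertex_mem_supported (k + 1) n)
  rw [simplexRestrict_single]
  refine Finsupp.single_mem_supported ℚ _ ?_
  have hmem : ∀ x, affineSimplex q x ∈ Metric.ball (q 0) ε := by
    intro x
    have : (affineSimplex q x : Fin (k + 1) → ℝ) ∈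
        Metric.ball (q 0 : Fin (k + 1) → ℝ) ε :=
      affineSimplex_mem_of_convex (convex_ball _ _) (fun i => (hq i 0).trans_lt hn) x
    exact this
  obtain ⟨b, hb⟩ := hball (q 0) (Set.mem_univ _)
  cases b
  · right
    rintro _ ⟨x, rfl⟩
    exact hb (hmem x)
  · left
    rintro _ ⟨x, rfl⟩
    exact hb (hmem x)

lemma exists_iterate_simplexSubdivision_mem_smallChains {U W : Set X} (hU : IsOpen U)
    (hW : IsOpen W) (hUW : U ∪ W = Set.univ) {k : ℕ} (c : SimplexChain X (k + 1)) :
    ∃ n, (simplexSubdivision (k + 1))^[n] c ∈ smallChains U W (k + 1) := by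
  induction c using Finsupp.induction_linear with
  | zero => exact ⟨0, Submodule.zero_mem _⟩
  | add x y hx hy =>
    obtain ⟨n₁, h₁⟩ := hx
    obtain ⟨n₂, h₂⟩ := hy
    refine ⟨n₂ + n₁, ?_⟩
    rw [← Module.End.pow_apply, map_add]
    refine Submodule.add_mem _ ?_ ?_
    · rw [Module.End.pow_apply, Function.iterate_add_apply]
      exact iterate_simplexSubdivision_mem_smallChains h₁ _
    · rw [Module.End.pow_apply, add_comm n₂, Function.iterate_add_apply]
      exact iterate_simplexSubdivision_mem_smallChains h₂ _
  | single σ a =>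
    obtain ⟨n, hn⟩ := iterate_simplexSubdivision_single_mem_smallChains hU hW hUW σ
    refine ⟨n, ?_⟩
    rw [← mul_one a, ← smul_eq_mul, ← Finsupp.smul_single, ← Module.End.pow_apply, map_smul,
      Module.End.pow_apply]
    exact Submodule.smul_mem _ _ hn

/-- The small simplices theorem: a chain whose boundary is subordinate to an open cover by two
sets is homologous to a chain subordinate to the cover. -/
lemma exists_sub_simplexBoundary_mem_smallChains {U W : Set X} (hU : IsOpen U)
    (hW : IsOpen W) (hUW : U ∪ W = Set.univ) {k : ℕ} (c : SimplexChain X (k + 1))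
    (hc : simplexBoundary k c ∈ smallChains U W k) :
    ∃ e : SimplexChain X (k + 2), c - simplexBoundary (k + 1) e ∈ smallChains U W (k + 1) := by
  obtain ⟨n, hn⟩ := exists_iterate_simplexSubdivision_mem_smallChains hU hW hUW c
  induction n generalizing c with
  | zero => exact ⟨0, by simpa using hn⟩
  | succ n ih =>
    -- Replacing `c` by its subdivision changes `c` by `∂ (T c)` and by the small chain `T (∂ c)`.
    obtain ⟨e, he⟩ := ih (simplexSubdivision (k + 1) c)
      (by rw [simplexBoundary_simplexSubdivision]; exact simplexSubdivision_mem_smallChains hc) hn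
    refine ⟨e + simplexHomotopy (k + 1) c, ?_⟩
    rw [map_add, simplexBoundary_simplexHomotopy]
    have := Submodule.add_mem _ he (simplexHomotopy_mem_smallChains hc)
    convert this using 1
    abel

end SimplexChains

/-! ### Comparison with the singular chain complex -/

section SingularComplex

variable (X : Type) [TopologicalSpace X]

/-- The inclusion of the summand of a singular simplex into the singular chain complex. -/
noncomputable def singularSimplexChain (n : ℕ) (σ : C(stdSimplex ℝ (Fin (n + 1)), X)) :
    (rationalSingularChains X).X n :=
  (SSet.ιChainComplex (X := TopCat.toSSet.obj (TopCat.of X)) (R := ModuleCat.of ℚ ℚ)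
    ((TopCat.toSSetObjEquiv (TopCat.of X) (.op (.mk n))).symm σ)).hom (1 : ℚ)

/-- The identification of concrete singular chains with the terms of the singular chain complex. -/
noncomputable def singularChainEquiv (n : ℕ) :
    SimplexChain X (n + 1) ≃ₗ[ℚ] (rationalSingularChains X).X n := by
  let S := TopCat.toSSet.obj (TopCat.of X)
  let e := TopCat.toSSetObjEquiv (TopCat.of X) (.op (.mk n))
  let f : SimplexChain X (n + 1) →ₗ[ℚ] (rationalSingularChains X).X n :=
    Finsupp.linearCombination ℚ (singularSimplexChain X n)
  let c : Limits.Cofan (fun _ : S.obj (.op (.mk n)) => ModuleCat.of ℚ ℚ) :=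
    Limits.Cofan.mk (ModuleCat.of ℚ (SimplexChain X (n + 1)))
      fun x => ModuleCat.ofHom (Finsupp.lsingle (e x))
  let g : (rationalSingularChains X).X n ⟶ ModuleCat.of ℚ (SimplexChain X (n + 1)) :=
    (S.isColimitChainComplexXCofan (ModuleCat.of ℚ ℚ) n).desc c
  have hg : ∀ x : S.obj (.op (.mk n)),
      S.ιChainComplex (R := ModuleCat.of ℚ ℚ) x ≫ g = ModuleCat.ofHom (Finsupp.lsingle (e x)) :=
    fun x => (S.isColimitChainComplexXCofan (ModuleCat.of ℚ ℚ) n).fac c ⟨x⟩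
  have hg' : ∀ x : S.obj (.op (.mk n)),
      g.hom ((S.ιChainComplex (R := ModuleCat.of ℚ ℚ) x).hom (1 : ℚ)) =
        Finsupp.single (e x) (1 : ℚ) :=
    fun x => congrArg (fun h => h.hom (1 : ℚ)) (hg x)
  have hf : ∀ σ, f (Finsupp.single σ 1) = singularSimplexChain X n σ := fun σ => by simp [f]
  refine LinearEquiv.ofLinearMap f g.hom ?_ ?_
  · have : g ≫ ModuleCat.ofHom f = 𝟙 _ := by
      refine SSet.chainComplex_hom_ext fun x => ?_
      apply ModuleCat.hom_ext
      refine LinearMap.ext_ring ?_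
      change f (g.hom ((S.ιChainComplex (R := ModuleCat.of ℚ ℚ) x).hom (1 : ℚ))) = _
      rw [hg', hf]
      change (S.ιChainComplex (R := ModuleCat.of ℚ ℚ) (e.symm (e x))).hom (1 : ℚ) = _
      rw [e.symm_apply_apply]
      rfl
    exact congrArg ModuleCat.Hom.hom this
  · refine Finsupp.lhom_ext' fun σ => LinearMap.ext_ring ?_
    change g.hom (f (Finsupp.single σ 1)) = Finsupp.single σ 1
    rw [hf]
    exact (hg' _).trans (by rw [e.apply_symm_apply])

variable {X}

lemma singularChainEquiv_single (n : ℕ) (σ : C(stdSimplex ℝ (Fin (n + 1)), X)) :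
    singularChainEquiv X n (Finsupp.single σ 1) = singularSimplexChain X n σ := by
  change Finsupp.linearCombination ℚ (singularSimplexChain X n) _ = _
  simp

lemma d_singularChainEquiv (n : ℕ) (c : SimplexChain X (n + 2)) :
    ((rationalSingularChains X).d (n + 1) n).hom (singularChainEquiv X (n + 1) c) =
      singularChainEquiv X n (simplexBoundary (n + 1) c) := by
  revert c
  refine LinearMap.congr_fun (f := ((rationalSingularChains X).d (n + 1) n).hom ∘ₗ
    (singularChainEquiv X (n + 1)).toLinearMap)
    (g := (singularChainEquiv X n).toLinearMap ∘ₗ simplexBoundary (n + 1)) ?_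
  refine Finsupp.lhom_ext' fun σ => LinearMap.ext_ring ?_
  simp only [LinearMap.comp_apply, Finsupp.lsingle_apply, LinearEquiv.coe_coe]
  rw [singularChainEquiv_single, simplexBoundary_single, map_sum]
  have h := congrArg (fun h => h.hom (1 : ℚ)) (SSet.ιChainComplex_d (R := ModuleCat.of ℚ ℚ)
    (TopCat.toSSet.obj (TopCat.of X))
    ((TopCat.toSSetObjEquiv (TopCat.of X) (.op (.mk (n + 1)))).symm σ))
  refine h.trans ?_
  simp only [map_smul, singularChainEquiv_single, ModuleCat.hom_sum]
  rw [LinearMap.sum_apply]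
  refine Finset.sum_congr rfl fun i _ => ?_
  have hz : ∀ (M : ModuleCat.{0} ℚ) (x : M), ((-1 : ℤ) ^ (i : ℕ)) • x = ((-1 : ℚ) ^ (i : ℕ)) • x := by
    intro M x
    rw [← Int.cast_smul_eq_zsmul ℚ]
    push_cast
    rfl
  exact hz _ _

/-- The map on singular chain complexes induced by a continuous map. -/
noncomputable def rationalSingularMap {Y : Type} [TopologicalSpace Y] (f : C(X, Y)) :
    rationalSingularChains X ⟶ rationalSingularChains Y :=
  ((singularChainComplexFunctor (ModuleCat.{0} ℚ)).obj (ModuleCat.of ℚ ℚ)).map (TopCat.ofHom f)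

lemma rationalSingularMap_singularChainEquiv {Y : Type} [TopologicalSpace Y] (f : C(X, Y)) (n : ℕ)
    (c : SimplexChain X (n + 1)) :
    ((rationalSingularMap f).f n).hom (singularChainEquiv X n c) =
      singularChainEquiv Y n (Finsupp.lmapDomain ℚ ℚ (fun σ => f.comp σ) c) := by
  revert c
  refine LinearMap.congr_fun (f := ((rationalSingularMap f).f n).hom ∘ₗ
    (singularChainEquiv X n).toLinearMap)
    (g := (singularChainEquiv Y n).toLinearMap ∘ₗ
      Finsupp.lmapDomain ℚ ℚ (fun σ => f.comp σ)) ?_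
  refine Finsupp.lhom_ext' fun σ => LinearMap.ext_ring ?_
  simp only [LinearMap.comp_apply, Finsupp.lsingle_apply, LinearEquiv.coe_coe,
    Finsupp.lmapDomain_apply, Finsupp.mapDomain_single]
  rw [singularChainEquiv_single, singularChainEquiv_single]
  exact congrArg (fun h => (ModuleCat.Hom.hom h) (1 : ℚ)) (SSet.ι_chainComplexMap_f
    (TopCat.toSSet.obj (TopCat.of X)) (TopCat.toSSet.obj (TopCat.of Y))
    (TopCat.toSSet.map (TopCat.ofHom f)) (ModuleCat.of ℚ ℚ)
    ((TopCat.toSSetObjEquiv (TopCat.of X) (.op (.mk n))).symm σ))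

lemma rationalSingularMap_comp {Y Z : Type} [TopologicalSpace Y] [TopologicalSpace Z]
    (g : C(Y, Z)) (f : C(X, Y)) :
    rationalSingularMap (g.comp f) = rationalSingularMap f ≫ rationalSingularMap g :=
  ((singularChainComplexFunctor (ModuleCat.{0} ℚ)).obj (ModuleCat.of ℚ ℚ)).map_comp
    (TopCat.ofHom f) (TopCat.ofHom g)

lemma rationalSingularMap_id :
    rationalSingularMap (ContinuousMap.id X) = 𝟙 (rationalSingularChains X) :=
  ((singularChainComplexFunctor (ModuleCat.{0} ℚ)).obj (ModuleCat.of ℚ ℚ)).map_id (TopCat.of X)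

lemma homologyMap_eq_of_homotopic {Y : Type} [TopologicalSpace Y] {f g : C(X, Y)}
    (h : f.Homotopic g) (n : ℕ) :
    HomologicalComplex.homologyMap (rationalSingularMap f) n =
      HomologicalComplex.homologyMap (rationalSingularMap g) n :=
  TopCat.Homotopy.congr_homologyMap_singularChainComplexFunctor
    (f := TopCat.ofHom f) (g := TopCat.ofHom g) h.some (ModuleCat.of ℚ ℚ) n

end SingularComplex

/-! ### Homotopy invariance and Mayer–Vietoris for the Euler characteristic -/

section EulerCharacteristic

/-- The rational homology of `X` is finite-dimensional and the Euler characteristic of `X`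
is `k`. -/
def HasEulerChar (X : Type) [TopologicalSpace X] (k : ℤ) : Prop :=
  HasFiniteRationalHomology X ∧ topologicalEulerChar X = k

variable {X Y : Type} [TopologicalSpace X] [TopologicalSpace Y]

lemma HasEulerChar.of_homotopyEquiv (e : ContinuousMap.HomotopyEquiv X Y) {k : ℤ}
    (h : HasEulerChar X k) : HasEulerChar Y k := by
  refine HasChainEulerChar.of_iso (fun i => ⟨LinearEquiv.ofLinearMap
    (HomologicalComplex.homologyMap (rationalSingularMap e.toFun) i).hom
    (HomologicalComplex.homologyMap (rationalSingularMap e.invFun) i).hom ?_ ?_⟩) h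
  · rw [← ModuleCat.hom_comp, ← HomologicalComplex.homologyMap_comp, ← rationalSingularMap_comp,
      homologyMap_eq_of_homotopic e.right_inv, rationalSingularMap_id,
      HomologicalComplex.homologyMap_id, ModuleCat.hom_id]
  · rw [← ModuleCat.hom_comp, ← HomologicalComplex.homologyMap_comp, ← rationalSingularMap_comp,
      homologyMap_eq_of_homotopic e.left_inv, rationalSingularMap_id,
      HomologicalComplex.homologyMap_id, ModuleCat.hom_id]

lemma HasEulerChar.of_homeomorph (e : X ≃ₜ Y) {k : ℤ} (h : HasEulerChar X k) :
    HasEulerChar Y k :=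
  h.of_homotopyEquiv e.toHomotopyEquiv

lemma HasEulerChar.congr {k l : ℤ} (h : HasEulerChar X k) (hkl : k = l) : HasEulerChar X l :=
  hkl ▸ h

lemma hasEulerChar_of_isEmpty [IsEmpty X] : HasEulerChar X 0 := by
  refine HasChainEulerChar.of_acyclic fun i => ?_
  have : IsEmpty C(stdSimplex ℝ (Fin (i + 1)), X) :=
    ⟨fun σ => IsEmpty.false (σ (Classical.arbitrary _))⟩
  have : Subsingleton ((rationalSingularChains X).X i) :=
    (singularChainEquiv X i).symm.toEquiv.subsingleton
  rw [← ModuleCat.isZero_iff_subsingleton, ← HomologicalComplex.exactAt_iff_isZero_homology]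
  exact ShortComplex.exact_of_isZero_X₂ _ (ModuleCat.isZero_of_subsingleton ((rationalSingularChains X).X i))

lemma hasEulerChar_unit : HasEulerChar Unit 1 := by
  have e : (rationalSingularChains Unit).homology 0 ≅ ModuleCat.of ℚ ℚ :=
    singularHomologyFunctorZeroOfTotallyDisconnectedSpace (ModuleCat.{0} ℚ)
      (ModuleCat.of ℚ ℚ) (TopCat.of Unit) ≪≫
      Limits.coproductUniqueIso (β := Unit) fun _ => ModuleCat.of ℚ ℚ
  have : Module.Finite ℚ ((rationalSingularChains Unit).homology 0) :=
    Module.Finite.equiv e.symm.toLinearEquiv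
  refine HasChainEulerChar.of_degree_zero (k := 1) (fun i hi => ?_) ?_
  · rw [← ModuleCat.isZero_iff_subsingleton]
    exact isZero_singularHomologyFunctor_of_totallyDisconnectedSpace (ModuleCat.{0} ℚ) i
      (ModuleCat.of ℚ ℚ) (TopCat.of Unit) hi
  · rw [e.toLinearEquiv.finrank_eq]
    exact Module.finrank_self ℚ

/-- Mayer–Vietoris for the cover of `X` by two open subsets. -/
lemma HasEulerChar.of_open_cover {U W : Set X} (hU : IsOpen U) (hW : IsOpen W)
    (hUW : U ∪ W = Set.univ) {a b p : ℤ} (ha : HasEulerChar U a) (hb : HasEulerChar W b)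
    (hp : HasEulerChar ↥(U ∩ W) p) : HasEulerChar X (a + b - p) := by
  let jU : C(U, X) := ⟨Subtype.val, continuous_subtype_val⟩
  let jW : C(W, X) := ⟨Subtype.val, continuous_subtype_val⟩
  let iU : C(↥(U ∩ W), U) := ⟨Set.inclusion Set.inter_subset_left, continuous_inclusion _⟩
  let iW : C(↥(U ∩ W), W) := ⟨Set.inclusion Set.inter_subset_right, continuous_inclusion _⟩
  have inj : ∀ {A B : Type} [TopologicalSpace A] [TopologicalSpace B] (f : C(A, B)),
      Function.Injective f → ∀ k, Function.Injective
        (Finsupp.lmapDomain ℚ ℚ fun σ : C(stdSimplex ℝ (Fin k), A) => f.comp σ) := by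
    intro A B _ _ f hf k
    refine Finsupp.mapDomain_injective fun σ τ h => ?_
    ext1 x
    exact hf (congrArg (fun g => g x) h)
  -- A chain of `A` is a chain of `X` supported on the simplices that factor through `A`.
  have range_eq : ∀ {A : Set X} (j : C(A, X)), (∀ a, j a = a) → ∀ n,
      LinearMap.range ((rationalSingularMap j).f n).hom =
        (Finsupp.supported ℚ ℚ {σ : C(stdSimplex ℝ (Fin (n + 1)), X) | Set.range σ ⊆ A}).map
          (singularChainEquiv X n).toLinearMap := by
    intro A j hj n
    have h1 : LinearMap.range ((rationalSingularMap j).f n).hom =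
        (LinearMap.range (Finsupp.lmapDomain ℚ ℚ
          fun σ : C(stdSimplex ℝ (Fin (n + 1)), A) => j.comp σ)).map
          (singularChainEquiv X n).toLinearMap := by
      ext x
      constructor
      · rintro ⟨y, rfl⟩
        obtain ⟨c, rfl⟩ := (singularChainEquiv A n).surjective y
        rw [rationalSingularMap_singularChainEquiv]
        exact ⟨_, ⟨c, rfl⟩, rfl⟩
      · rintro ⟨_, ⟨c, rfl⟩, rfl⟩
        exact ⟨singularChainEquiv A n c, rationalSingularMap_singularChainEquiv _ _ _⟩
    rw [h1, Finsupp.range_lmapDomain, Finsupp.supported_eq_span_single]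
    congr 2
    ext c
    constructor
    · rintro ⟨σ, rfl⟩
      refine ⟨j.comp σ, ?_, rfl⟩
      rintro _ ⟨x, rfl⟩
      rw [ContinuousMap.comp_apply, hj]
      exact (σ x).2
    · rintro ⟨σ, hσ, rfl⟩
      refine ⟨⟨fun x => ⟨σ x, hσ ⟨x, rfl⟩⟩, by fun_prop⟩, ?_⟩
      refine congrArg (fun τ => Finsupp.single τ (1 : ℚ)) ?_
      ext1 x
      exact hj _
  have sup_eq : ∀ n, LinearMap.range ((rationalSingularMap jU).f n).hom ⊔
      LinearMap.range ((rationalSingularMap jW).f n).hom =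
        (smallChains U W (n + 1)).map (singularChainEquiv X n).toLinearMap := by
    intro n
    rw [range_eq jU (fun _ => rfl), range_eq jW (fun _ => rfl), ← Submodule.map_sup,
      ← Finsupp.supported_union]
    rfl
  refine HasChainEulerChar.mayerVietoris (rationalSingularMap iU) (rationalSingularMap iW)
    (rationalSingularMap jU) (rationalSingularMap jW) ?_ ?_ ?_ ?_ ha hb hp
  · rw [← rationalSingularMap_comp, ← rationalSingularMap_comp]
    rfl
  · intro n x y hxy
    obtain ⟨c, rfl⟩ := (singularChainEquiv _ n).surjective x
    obtain ⟨d, rfl⟩ := (singularChainEquiv _ n).surjective y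
    rw [rationalSingularMap_singularChainEquiv, rationalSingularMap_singularChainEquiv] at hxy
    rw [inj iU (Set.inclusion_injective Set.inter_subset_left) _ ((singularChainEquiv _ n).injective hxy)]
  · intro n a b hab
    have h1 : ((rationalSingularMap jU).f n).hom a ∈
        (Finsupp.supported ℚ ℚ {σ : C(stdSimplex ℝ (Fin (n + 1)), X) | Set.range σ ⊆ U ∩ W}).map
          (singularChainEquiv X n).toLinearMap := by
      have hU' : ((rationalSingularMap jU).f n).hom a ∈
          LinearMap.range ((rationalSingularMap jU).f n).hom := ⟨a, rfl⟩
      have hW' : ((rationalSingularMap jU).f n).hom a ∈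
          LinearMap.range ((rationalSingularMap jW).f n).hom := ⟨b, hab.symm⟩
      rw [range_eq jU (fun _ => rfl)] at hU'
      rw [range_eq jW (fun _ => rfl)] at hW'
      obtain ⟨c, hc, hc'⟩ := hU'
      obtain ⟨d, hd, hd'⟩ := hW'
      obtain rfl : c = d := (singularChainEquiv X n).injective (hc'.trans hd'.symm)
      refine ⟨c, ?_, hc'⟩
      have hset : {σ : C(stdSimplex ℝ (Fin (n + 1)), X) | Set.range σ ⊆ U ∩ W} =
          {σ : C(stdSimplex ℝ (Fin (n + 1)), X) | Set.range σ ⊆ U} ∩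
          {σ : C(stdSimplex ℝ (Fin (n + 1)), X) | Set.range σ ⊆ W} := by
        ext σ
        exact Set.subset_inter_iff
      rw [hset, Finsupp.supported_inter]
      exact ⟨hc, hd⟩
    let jP : C(↥(U ∩ W), X) := ⟨Subtype.val, continuous_subtype_val⟩
    have hinj : ∀ {A : Set X} (j : C(A, X)), (∀ a, j a = a) →
        Function.Injective ((rationalSingularMap j).f n).hom := by
      intro A j hj x y hxy
      obtain ⟨c, rfl⟩ := (singularChainEquiv _ n).surjective x
      obtain ⟨d, rfl⟩ := (singularChainEquiv _ n).surjective y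
      rw [rationalSingularMap_singularChainEquiv, rationalSingularMap_singularChainEquiv] at hxy
      rw [inj j (fun a b h => Subtype.ext (by rwa [hj, hj] at h)) _
        ((singularChainEquiv _ n).injective hxy)]
    rw [← range_eq jP (fun _ => rfl)] at h1
    obtain ⟨p, hp⟩ := h1
    have hpU : ((rationalSingularMap jU).f n).hom (((rationalSingularMap iU).f n).hom p) =
        ((rationalSingularMap jP).f n).hom p :=
      congrArg (fun f => ModuleCat.Hom.hom (HomologicalComplex.Hom.f f n) p)
        (rationalSingularMap_comp jU iU).symm
    have hpW : ((rationalSingularMap jW).f n).hom (((rationalSingularMap iW).f n).hom p) =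
        ((rationalSingularMap jP).f n).hom p :=
      congrArg (fun f => ModuleCat.Hom.hom (HomologicalComplex.Hom.f f n) p)
        (rationalSingularMap_comp jW iW).symm
    exact ⟨p, hinj jU (fun _ => rfl) (hpU.trans hp),
      hinj jW (fun _ => rfl) (hpW.trans (hp.trans hab))⟩
  · intro n x hx
    obtain ⟨c, rfl⟩ := (singularChainEquiv X n).surjective x
    suffices h : ∃ e, c - simplexBoundary (n + 1) e ∈ smallChains U W (n + 1) by
      obtain ⟨e, he⟩ := h
      refine ⟨singularChainEquiv X (n + 1) e, ?_⟩
      rw [sup_eq, d_singularChainEquiv, ← map_sub]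
      exact ⟨_, he, rfl⟩
    cases n with
    | zero =>
      refine ⟨0, ?_⟩
      -- A singular `0`-simplex is a point, so that every `0`-chain is small.
      have : {σ : C(stdSimplex ℝ (Fin 1), X) | Set.range σ ⊆ U ∨ Set.range σ ⊆ W} =
          Set.univ := by
        refine Set.eq_univ_of_forall fun σ => ?_
        have hx0 : ∀ x, σ x = σ default := fun x => congrArg σ (Subsingleton.elim _ _)
        rcases hUW.ge (Set.mem_univ (σ default)) with h | h
        · left
          rintro _ ⟨x, rfl⟩
          rwa [hx0]
        · right
          rintro _ ⟨x, rfl⟩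
          rwa [hx0]
      rw [smallChains, this]
      simp
    | succ n =>
      refine exists_sub_simplexBoundary_mem_smallChains hU hW hUW c ?_
      have := hx n
      rw [sup_eq, d_singularChainEquiv] at this
      obtain ⟨d, hd, hd'⟩ := this
      rwa [← (singularChainEquiv X n).injective hd']

/-- Mayer–Vietoris for a subset `T` of `Y` covered by two open subsets of `Y`. -/
lemma HasEulerChar.of_subset_cover {T U W : Set Y} (hU : IsOpen U) (hW : IsOpen W)
    (hT : T ⊆ U ∪ W) {a b p : ℤ} (ha : HasEulerChar ↥(T ∩ U) a) (hb : HasEulerChar ↥(T ∩ W) b)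
    (hp : HasEulerChar ↥(T ∩ (U ∩ W)) p) : HasEulerChar T (a + b - p) := by
  have e : ∀ A : Set Y, Nonempty (↥(T ∩ A) ≃ₜ ↥((↑) ⁻¹' A : Set T)) := fun A =>
    ⟨{ toFun := fun x => ⟨⟨x.1, x.2.1⟩, x.2.2⟩
       invFun := fun x => ⟨x.1.1, x.1.2, x.2⟩
       left_inv := fun _ => rfl
       right_inv := fun _ => rfl
       continuous_toFun := by fun_prop
       continuous_invFun := by fun_prop }⟩
  refine HasEulerChar.of_open_cover (hU.preimage continuous_subtype_val)
    (hW.preimage continuous_subtype_val) ?_ (ha.of_homeomorph (e U).some)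
    (hb.of_homeomorph (e W).some) (hp.of_homeomorph (e (U ∩ W)).some)
  exact Set.eq_univ_of_forall fun x => hT x.2

end EulerCharacteristic

/-! ### Deformations of subsets -/

section Deformation

variable {α β : Type} [TopologicalSpace α] [TopologicalSpace β] {S : Set α} {T : Set β}

/-- If `f : S → T` has a section `g : T → S` such that `g ∘ f` is homotopic to the identity of `S`,
then `S` and `T` have the same Euler characteristic. All maps are given on the ambient spaces. -/
lemma hasEulerChar_iff_of_deformation (f : α → β) (g : β → α) (H : ℝ × α → α)
    (hf : ContinuousOn f S) (hfST : ∀ a ∈ S, f a ∈ T) (hg : ContinuousOn g T)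
    (hgTS : ∀ b ∈ T, g b ∈ S) (hfg : ∀ b ∈ T, f (g b) = b)
    (hH : ContinuousOn H (Set.Icc 0 1 ×ˢ S)) (hHS : ∀ s ∈ Set.Icc (0 : ℝ) 1, ∀ a ∈ S, H (s, a) ∈ S)
    (hH0 : ∀ a ∈ S, H (0, a) = g (f a)) (hH1 : ∀ a ∈ S, H (1, a) = a) {k : ℤ} :
    HasEulerChar S k ↔ HasEulerChar T k := by
  have hf' : Continuous fun a : S => (⟨f a, hfST a a.2⟩ : T) :=
    (continuousOn_iff_continuous_domRestrict.mp hf).subtype_mk _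
  have hg' : Continuous fun b : T => (⟨g b, hgTS b b.2⟩ : S) :=
    (continuousOn_iff_continuous_domRestrict.mp hg).subtype_mk _
  have hH' : Continuous fun p : unitInterval × S =>
      (⟨H (p.1, p.2), hHS p.1 p.1.2 p.2 p.2.2⟩ : S) := by
    refine Continuous.subtype_mk ?_ _
    exact hH.comp_continuous (f := fun p : unitInterval × S => ((p.1 : ℝ), (p.2 : α)))
      (by fun_prop) fun p => ⟨p.1.2, p.2.2⟩
  let e : ContinuousMap.HomotopyEquiv S T :=
    { toFun := ⟨_, hf'⟩
      invFun := ⟨_, hg'⟩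
      left_inv := ⟨⟨⟨_, hH'⟩, fun a => Subtype.ext (hH0 a a.2), fun a => Subtype.ext (hH1 a a.2)⟩⟩
      right_inv := by
        rw [show (⟨_, hf'⟩ : C(S, T)).comp ⟨_, hg'⟩ = ContinuousMap.id T from
          ContinuousMap.ext fun b => Subtype.ext (hfg b b.2)] }
  exact ⟨fun h => h.of_homotopyEquiv e, fun h => h.of_homotopyEquiv e.symm⟩

lemma hasEulerChar_iff_of_inverse (f : α → β) (g : β → α)
    (hf : ContinuousOn f S) (hfST : ∀ a ∈ S, f a ∈ T) (hg : ContinuousOn g T)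
    (hgTS : ∀ b ∈ T, g b ∈ S) (hfg : ∀ b ∈ T, f (g b) = b) (hgf : ∀ a ∈ S, g (f a) = a) {k : ℤ} :
    HasEulerChar S k ↔ HasEulerChar T k :=
  hasEulerChar_iff_of_deformation f g Prod.snd hf hfST hg hgTS hfg continuousOn_snd
    (fun _ _ _ h => h) (fun a ha => (hgf a ha).symm) fun _ _ => rfl

lemma hasEulerChar_of_eq_empty (hS : S = ∅) : HasEulerChar S 0 := by
  subst hS
  exact hasEulerChar_of_isEmpty

end Deformation

/-! ### Products with punctured lines, and punctured real spaces -/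

section Products

variable {α : Type} [TopologicalSpace α] {T : Set α} {k : ℤ}

/-- The product with `ℝ ∖ {0}` is a disjoint union of two copies up to homotopy. -/
lemma HasEulerChar.prod_real_ne_zero (h : HasEulerChar T k) :
    HasEulerChar {p : α × ℝ | p.1 ∈ T ∧ p.2 ≠ 0} (2 * k) := by
  have hpos : HasEulerChar ↥({p : α × ℝ | p.1 ∈ T ∧ p.2 ≠ 0} ∩ {p | 0 < p.2}) k := by
    refine (hasEulerChar_iff_of_deformation Prod.fst (fun x => (x, 1))
      (fun p => (p.2.1, p.1 * p.2.2 + (1 - p.1))) (by fun_prop) (fun a ha => ha.1.1) (by fun_prop)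
      (fun b hb => ?_) (fun _ _ => rfl) (by fun_prop)
      (fun s hs a ha => ?_) (fun a _ => by simp) (fun a _ => by simp)).mpr h
    · exact ⟨⟨hb, one_ne_zero⟩, one_pos (α := ℝ)⟩
    have h1 : 0 < a.2 := ha.2
    have h2 : 0 < s * a.2 + (1 - s) := by
      rcases hs.2.eq_or_lt with rfl | h
      · simpa using h1
      · have := mul_nonneg hs.1 h1.le
        linarith
    exact ⟨⟨ha.1.1, h2.ne'⟩, h2⟩
  have hneg : HasEulerChar ↥({p : α × ℝ | p.1 ∈ T ∧ p.2 ≠ 0} ∩ {p | p.2 < 0}) k := by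
    refine (hasEulerChar_iff_of_inverse (fun p => (p.1, -p.2)) (fun p => (p.1, -p.2))
      (by fun_prop) (fun a ha => ?_) (by fun_prop) (fun a ha => ?_) (by simp) (by simp)).mpr hpos
    · exact ⟨⟨ha.1.1, neg_ne_zero.mpr ha.1.2⟩, by simpa using ha.2⟩
    · exact ⟨⟨ha.1.1, neg_ne_zero.mpr ha.1.2⟩, by simpa using ha.2⟩
  refine (HasEulerChar.of_subset_cover (isOpen_lt continuous_const continuous_snd)
    (isOpen_lt continuous_snd continuous_const) (fun p hp => (lt_or_gt_of_ne hp.2).symm)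
    hpos hneg (hasEulerChar_of_eq_empty ?_)).congr (by ring)
  refine Set.eq_empty_of_forall_notMem fun p hp => ?_
  exact lt_asymm (a := p.2) hp.2.2 hp.2.1

/-- The product with `ℂ ∖ {0}` has Euler characteristic `0`: the parts `re ≠ 0` and `im ≠ 0` have
are each two copies of `T` up to homotopy, and their intersection is four copies. -/
lemma HasEulerChar.prod_complex_ne_zero (h : HasEulerChar T k) :
    HasEulerChar {p : α × ℂ | p.1 ∈ T ∧ p.2 ≠ 0} 0 := by
  have hre : HasEulerChar ↥({p : α × ℂ | p.1 ∈ T ∧ p.2 ≠ 0} ∩ {p | p.2.re ≠ 0}) (2 * k) := by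
    refine (hasEulerChar_iff_of_deformation (T := {p : α × ℝ | p.1 ∈ T ∧ p.2 ≠ 0})
      (fun p => (p.1, p.2.re)) (fun p => (p.1, (p.2 : ℂ)))
      (fun p => (p.2.1, (p.2.2.re : ℂ) + p.1 * p.2.2.im * Complex.I)) (by fun_prop)
      (fun a ha => ?_) (by fun_prop) (fun b hb => ?_) (fun b _ => by simp)
      (by fun_prop) (fun s hs a ha => ?_) (fun a _ => by simp) (fun a _ => ?_)).mpr
        h.prod_real_ne_zero
    · exact ⟨ha.1.1, ha.2⟩
    · exact ⟨⟨hb.1, Complex.ofReal_ne_zero.mpr hb.2⟩, hb.2⟩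
    · have h1 : ((a.2.re : ℂ) + s * a.2.im * Complex.I).re ≠ 0 := by simpa using ha.2
      refine ⟨⟨ha.1.1, fun h0 => h1 ?_⟩, h1⟩
      exact (congrArg Complex.re h0).trans Complex.zero_re
    · refine Prod.ext rfl ?_
      change (a.2.re : ℂ) + (1 : ℝ) * a.2.im * Complex.I = a.2
      rw [Complex.ofReal_one, one_mul, Complex.re_add_im]
  have him : HasEulerChar ↥({p : α × ℂ | p.1 ∈ T ∧ p.2 ≠ 0} ∩ {p | p.2.im ≠ 0}) (2 * k) := by
    refine (hasEulerChar_iff_of_inverse (fun p => (p.1, Complex.I * p.2))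
      (fun p => (p.1, -Complex.I * p.2)) (by fun_prop) (fun a ha => ?_) (by fun_prop)
      (fun a ha => ?_) (fun a _ => ?_) (fun a _ => ?_)).mpr hre
    · exact ⟨⟨ha.1.1, mul_ne_zero Complex.I_ne_zero ha.1.2⟩, by simpa using ha.2⟩
    · exact ⟨⟨ha.1.1, mul_ne_zero (neg_ne_zero.mpr Complex.I_ne_zero) ha.1.2⟩, by
        simpa using ha.2⟩
    · simp [← mul_assoc]
    · simp [← mul_assoc]
  have hint : HasEulerChar ↥({p : α × ℂ | p.1 ∈ T ∧ p.2 ≠ 0} ∩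
      ({p | p.2.re ≠ 0} ∩ {p | p.2.im ≠ 0})) (2 * (2 * k)) := by
    refine (hasEulerChar_iff_of_inverse
      (T := {p : (α × ℝ) × ℝ | p.1 ∈ {p : α × ℝ | p.1 ∈ T ∧ p.2 ≠ 0} ∧ p.2 ≠ 0})
      (fun p => ((p.1, p.2.re), p.2.im))
      (fun p => (p.1.1, (p.1.2 : ℂ) + p.2 * Complex.I)) (by fun_prop)
      (fun a ha => ?_) (by fun_prop) (fun a ha => ?_)
      (fun a _ => by simp) (fun a _ => by simp)).mpr h.prod_real_ne_zero.prod_real_ne_zero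
    · exact ⟨⟨ha.1.1, ha.2.1⟩, ha.2.2⟩
    have h1 : ((a.1.2 : ℂ) + a.2 * Complex.I).re ≠ 0 := by simpa using ha.1.2
    exact ⟨⟨ha.1.1, fun h0 => h1 ((congrArg Complex.re h0).trans Complex.zero_re)⟩, h1,
      by simpa using ha.2⟩
  refine (HasEulerChar.of_subset_cover
    (isOpen_ne_fun (by fun_prop) continuous_const)
    (isOpen_ne_fun (by fun_prop) continuous_const) (fun p hp => ?_) hre him hint).congr (by ring)
  by_contra hcon
  simp only [Set.mem_union, Set.mem_ofPred_eq, not_or, not_not] at hcon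
  exact hp.2 (Complex.ext hcon.1 hcon.2)

/-- The Euler characteristic of punctured real space, which is that of a sphere. The open cover
consists of the vectors with nonzero first coordinate and of those with a nonzero later one. -/
lemma hasEulerChar_punctured (r : ℕ) :
    HasEulerChar {v : Fin r → ℝ | v ≠ 0} (1 - (-1) ^ r) := by
  induction r with
  | zero =>
    refine (hasEulerChar_of_eq_empty ?_).congr (by norm_num)
    exact Set.eq_empty_of_forall_notMem fun v hv => hv (Subsingleton.elim _ _)
  | succ r ih =>
    have hcons : ∀ (x : ℝ) (v : Fin r → ℝ), (Fin.cons x v : Fin (r + 1) → ℝ) = 0 ↔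
        x = 0 ∧ v = 0 := by
      intro x v
      rw [← Fin.cons_self_tail (0 : Fin (r + 1) → ℝ), Fin.cons_inj]
      rfl
    have h0 : HasEulerChar ↥({v : Fin (r + 1) → ℝ | v ≠ 0} ∩ {v | v 0 ≠ 0}) 2 := by
      have h1 : HasEulerChar (Set.univ : Set Unit) 1 :=
        hasEulerChar_unit.of_homeomorph (Homeomorph.Set.univ Unit).symm
      refine (hasEulerChar_iff_of_deformation (fun v => ((), v 0)) (fun p => Fin.cons p.2 0)
        (fun p => Fin.cons (p.2 0) (p.1 • Fin.tail p.2)) (by fun_prop)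
        (fun a ha => ?_) (by fun_prop) (fun b hb => ?_) (fun _ _ => rfl)
        (by fun_prop) (fun s hs a ha => ?_) (fun a _ => by simp) (fun a _ => by simp)).mpr
        h1.prod_real_ne_zero
      · exact ⟨trivial, ha.2⟩
      · exact ⟨fun h => hb.2 ((hcons _ _).mp h).1, hb.2⟩
      · exact ⟨fun h => ha.2 ((hcons _ _).mp h).1, ha.2⟩
    have ht : HasEulerChar ↥({v : Fin (r + 1) → ℝ | v ≠ 0} ∩ {v | Fin.tail v ≠ 0})
        (1 - (-1) ^ r) := by
      refine (hasEulerChar_iff_of_deformation Fin.tail (Fin.cons 0)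
        (fun p => Fin.cons (p.1 * p.2 0) (Fin.tail p.2)) (by fun_prop)
        (fun a ha => ha.2) (by fun_prop) (fun b hb => ?_) (fun _ _ => rfl)
        (by fun_prop) (fun s hs a ha => ?_) (fun a _ => by simp) (fun a _ => by simp)).mpr ih
      · exact ⟨fun h => hb ((hcons _ _).mp h).2, hb⟩
      · exact ⟨fun h => ha.2 ((hcons _ _).mp h).2, ha.2⟩
    have hi : HasEulerChar ↥({v : Fin (r + 1) → ℝ | v ≠ 0} ∩
        ({v | v 0 ≠ 0} ∩ {v | Fin.tail v ≠ 0})) (2 * (1 - (-1) ^ r)) := by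
      refine (hasEulerChar_iff_of_inverse (fun v => (Fin.tail v, v 0)) (fun p => Fin.cons p.2 p.1)
        (by fun_prop) (fun a ha => ?_) (by fun_prop) (fun b hb => ?_)
        (fun _ _ => rfl) (fun a _ => by simp)).mpr ih.prod_real_ne_zero
      · exact ⟨ha.2.2, ha.2.1⟩
      exact ⟨fun h => hb.2 ((hcons _ _).mp h).1, hb.2, hb.1⟩
    refine (HasEulerChar.of_subset_cover
      (isOpen_ne_fun (by fun_prop) continuous_const)
      (isOpen_ne_fun (by fun_prop) continuous_const) (fun v hv => ?_) h0 ht hi).congr (by ring)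
    by_contra hcon
    simp only [Set.mem_union, Set.mem_ofPred_eq, not_or, not_not] at hcon
    refine hv ?_
    rw [← Fin.cons_self_tail v, hcons]
    exact hcon

end Products

/-! ### Complex cones and their projectivizations -/

section Cones

/-- A complex cone: a set of nonzero vectors that is stable under nonzero scalars. -/
def IsComplexCone {V : Type*} [AddCommGroup V] [Module ℂ V] (S : Set V) : Prop :=
  0 ∉ S ∧ ∀ c : ℂ, c ≠ 0 → ∀ v ∈ S, c • v ∈ S

/-- The subset of projective space whose points are the lines in the cone `S`. -/
def projSet {V : Type*} [AddCommGroup V] [Module ℂ V] (S : Set V) : Set (Projectivization ℂ V) :=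
  {x | x.rep ∈ S}

variable {V W : Type*} [AddCommGroup V] [Module ℂ V] [AddCommGroup W] [Module ℂ W]
  {S : Set V} {T : Set W}

lemma IsComplexCone.ne_zero (hS : IsComplexCone S) {v : V} (hv : v ∈ S) : v ≠ 0 := by
  rintro rfl
  exact hS.1 hv

lemma IsComplexCone.inter {S' : Set V} (hS : IsComplexCone S) (hS' : IsComplexCone S') :
    IsComplexCone (S ∩ S') :=
  ⟨fun h => hS.1 h.1, fun c hc v hv => ⟨hS.2 c hc v hv.1, hS'.2 c hc v hv.2⟩⟩

lemma IsComplexCone.mk_mem_projSet (hS : IsComplexCone S) {v : V} (hv : v ≠ 0) :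
    Projectivization.mk ℂ v hv ∈ projSet S ↔ v ∈ S := by
  obtain ⟨a, ha⟩ := Projectivization.exists_smul_eq_mk_rep ℂ v hv
  change (Projectivization.mk ℂ v hv).rep ∈ S ↔ v ∈ S
  rw [← ha]
  refine ⟨fun h => ?_, fun h => hS.2 a a.ne_zero v h⟩
  have := hS.2 (a⁻¹ : ℂˣ) (a⁻¹).ne_zero _ h
  rwa [Units.smul_def, smul_smul, ← Units.val_mul, inv_mul_cancel, Units.val_one, one_smul] at this

/-- The quotient map from a cone to its projectivization. -/
noncomputable def coneProj (hS : IsComplexCone S) (v : S) : projSet S :=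
  ⟨Projectivization.mk ℂ v.1 (hS.ne_zero v.2), (hS.mk_mem_projSet _).mpr v.2⟩

/-- A vector of the cone `S` on the line `x`. -/
noncomputable def lineRep (x : projSet S) : S := ⟨x.1.rep, x.2⟩

lemma coneProj_lineRep (hS : IsComplexCone S) (x : projSet S) : coneProj hS (lineRep x) = x :=
  Subtype.ext (Projectivization.mk_rep _)

lemma lineRep_coneProj (hS : IsComplexCone S) (v : S) :
    ∃ c : ℂ, c ≠ 0 ∧ (lineRep (coneProj hS v)).1 = c • v.1 := by
  obtain ⟨a, ha⟩ := Projectivization.exists_smul_eq_mk_rep ℂ v.1 (hS.ne_zero v.2)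
  exact ⟨a, a.ne_zero, ha.symm⟩

lemma coneProj_eq_of_smul (hS : IsComplexCone S) {v w : S} {c : ℂ} (h : c • w.1 = v.1) :
    coneProj hS v = coneProj hS w :=
  Subtype.ext ((Projectivization.mk_eq_mk_iff' ℂ _ _ _ _).mpr ⟨c, h⟩)

variable [TopologicalSpace V] [TopologicalSpace W]

lemma continuous_projectivization_mk :
    Continuous fun v : {v : V // v ≠ 0} => Projectivization.mk ℂ v.1 v.2 :=
  continuous_quotient_mk'

lemma isOpenMap_projectivization_mk [ContinuousSMul ℂ V] :
    IsOpenMap fun v : {v : V // v ≠ 0} => Projectivization.mk ℂ v.1 v.2 := by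
  intro O hO
  change IsOpen ((fun v : {v : V // v ≠ 0} => Projectivization.mk ℂ v.1 v.2) ⁻¹' _)
  have : (fun v : {v : V // v ≠ 0} => Projectivization.mk ℂ v.1 v.2) ⁻¹'
      ((fun v : {v : V // v ≠ 0} => Projectivization.mk ℂ v.1 v.2) '' O) =
      ⋃ a : ℂˣ, (fun v : {v : V // v ≠ 0} =>
        (⟨a • v.1, (smul_ne_zero_iff_ne a).mpr v.2⟩ : {v : V // v ≠ 0})) ⁻¹' O := by
    ext v
    simp only [Set.mem_preimage, Set.mem_image, Set.mem_iUnion]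
    constructor
    · rintro ⟨w, hw, hwv⟩
      obtain ⟨a, ha⟩ := (Projectivization.mk_eq_mk_iff ℂ _ _ _ _).mp hwv
      refine ⟨a, ?_⟩
      rwa [show (⟨a • v.1, (smul_ne_zero_iff_ne a).mpr v.2⟩ : {v : V // v ≠ 0}) = w from
        Subtype.ext ha]
    · rintro ⟨a, ha⟩
      exact ⟨_, ha, (Projectivization.mk_eq_mk_iff ℂ _ _ _ _).mpr ⟨a, rfl⟩⟩
  rw [this]
  refine isOpen_iUnion fun a => hO.preimage ?_
  exact Continuous.subtype_mk (continuous_subtype_val.const_smul (a : ℂ)) _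

lemma isOpen_projSet (hS : IsComplexCone S) (hSo : IsOpen S) : IsOpen (projSet S) := by
  change IsOpen ((fun v : {v : V // v ≠ 0} => Projectivization.mk ℂ v.1 v.2) ⁻¹' _)
  have : (fun v : {v : V // v ≠ 0} => Projectivization.mk ℂ v.1 v.2) ⁻¹' projSet S =
      Subtype.val ⁻¹' S := by
    ext v
    exact hS.mk_mem_projSet v.2
  rw [this]
  exact hSo.preimage continuous_subtype_val

lemma continuous_coneProj (hS : IsComplexCone S) : Continuous (coneProj hS) := by
  refine Continuous.subtype_mk ?_ _
  exact continuous_projectivization_mk.comp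
    (Continuous.subtype_mk continuous_subtype_val fun v : S => hS.ne_zero v.2)

lemma isOpenQuotientMap_coneProj [ContinuousSMul ℂ V] (hS : IsComplexCone S) :
    IsOpenQuotientMap (coneProj hS) := by
  refine ⟨fun x => ⟨_, coneProj_lineRep hS x⟩, continuous_coneProj hS, fun O hO => ?_⟩
  obtain ⟨O', hO', rfl⟩ := hO
  refine ⟨_, isOpenMap_projectivization_mk _ (hO'.preimage continuous_subtype_val), ?_⟩
  ext x
  constructor
  · rintro ⟨v, hv, hvx⟩
    have hvS : v.1 ∈ S := (hS.mk_mem_projSet v.2).mp (by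
      have h := x.2
      rwa [← hvx] at h)
    exact ⟨⟨v.1, hvS⟩, hv, Subtype.ext hvx⟩
  · rintro ⟨v, hv, rfl⟩
    exact ⟨⟨v.1, hS.ne_zero v.2⟩, hv, rfl⟩

/-- A jointly continuous family of homogeneous maps between cones induces a jointly continuous
family of maps between their projectivizations. -/
lemma continuous_projSet_family [ContinuousSMul ℂ V] (hS : IsComplexCone S)
    (hT : IsComplexCone T) {Y : Type*} [TopologicalSpace Y] (F : Y → S → T)
    (hF : Continuous fun p : Y × S => F p.1 p.2)
    (hom : ∀ y (c : ℂ) (v w : S), c ≠ 0 → c • w.1 = v.1 → (F y v).1 = c • (F y w).1) :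
    Continuous fun p : Y × projSet S => coneProj hT (F p.1 (lineRep p.2)) := by
  have hq : IsOpenQuotientMap (Prod.map (id : Y → Y) (coneProj hS)) :=
    IsOpenQuotientMap.id.prodMap (isOpenQuotientMap_coneProj hS)
  rw [← hq.continuous_comp_iff]
  have : (fun p : Y × projSet S => coneProj hT (F p.1 (lineRep p.2))) ∘
      Prod.map (id : Y → Y) (coneProj hS) = fun p : Y × S => coneProj hT (F p.1 p.2) := by
    ext1 p
    obtain ⟨c, hc, hrep⟩ := lineRep_coneProj hS p.2
    exact coneProj_eq_of_smul hT (hom p.1 c _ p.2 hc hrep.symm).symm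
  rw [this]
  exact (continuous_coneProj hT).comp hF

end Cones

/-! ### Euler characteristics of complex cones -/

section ConeDeformation

variable {V W : Type} [AddCommGroup V] [Module ℂ V] [AddCommGroup W] [Module ℂ W]
  [TopologicalSpace V] [TopologicalSpace W] {S : Set V} {T : Set W}

/-- The set `S` is a cone, the Euler characteristic of `S` itself is zero, and that of its
projectivization is `k`. -/
def HasConeEulerChar (S : Set V) (k : ℤ) : Prop :=
  IsComplexCone S ∧ HasEulerChar S 0 ∧ HasEulerChar (projSet S) k

lemma HasConeEulerChar.congr {k l : ℤ} (h : HasConeEulerChar S k) (hkl : k = l) :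
    HasConeEulerChar S l :=
  hkl ▸ h

lemma hasConeEulerChar_empty : HasConeEulerChar (∅ : Set V) 0 :=
  ⟨⟨fun h => h, fun _ _ _ h => h.elim⟩, hasEulerChar_of_eq_empty rfl,
    hasEulerChar_of_eq_empty (Set.eq_empty_of_forall_notMem fun _ h => h)⟩

variable [ContinuousSMul ℂ V] [ContinuousSMul ℂ W]

/-- A deformation by homogeneous maps descends to the projectivizations. -/
lemma hasEulerChar_projSet_iff_of_deformation (hS : IsComplexCone S) (hT : IsComplexCone T)
    (f : V → W) (g : W → V) (H : ℝ × V → V)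
    (hf : ContinuousOn f S) (hfST : ∀ a ∈ S, f a ∈ T) (hg : ContinuousOn g T)
    (hgTS : ∀ b ∈ T, g b ∈ S) (hfg : ∀ b ∈ T, f (g b) = b)
    (hH : ContinuousOn H (Set.Icc 0 1 ×ˢ S)) (hHS : ∀ s ∈ Set.Icc (0 : ℝ) 1, ∀ a ∈ S, H (s, a) ∈ S)
    (hH0 : ∀ a ∈ S, H (0, a) = g (f a)) (hH1 : ∀ a ∈ S, H (1, a) = a)
    (hf_smul : ∀ (c : ℂ), c ≠ 0 → ∀ v ∈ S, f (c • v) = c • f v)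
    (hg_smul : ∀ (c : ℂ), c ≠ 0 → ∀ v ∈ T, g (c • v) = c • g v)
    (hH_smul : ∀ s (c : ℂ), c ≠ 0 → ∀ v ∈ S, H (s, c • v) = c • H (s, v)) {k : ℤ} :
    HasEulerChar (projSet S) k ↔ HasEulerChar (projSet T) k := by
  let F : Unit → S → T := fun _ a => ⟨f a, hfST a a.2⟩
  let G : Unit → T → S := fun _ b => ⟨g b, hgTS b b.2⟩
  let K : unitInterval → S → S := fun s a => ⟨H (s, a), hHS s s.2 a a.2⟩
  have hF : Continuous fun p : Unit × S => F p.1 p.2 :=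
    ((continuousOn_iff_continuous_domRestrict.mp hf).subtype_mk fun a => hfST a a.2).comp
      continuous_snd
  have hG : Continuous fun p : Unit × T => G p.1 p.2 :=
    ((continuousOn_iff_continuous_domRestrict.mp hg).subtype_mk fun a => hgTS a a.2).comp
      continuous_snd
  have hK : Continuous fun p : unitInterval × S => K p.1 p.2 := by
    refine Continuous.subtype_mk ?_ _
    exact hH.comp_continuous (f := fun p : unitInterval × S => ((p.1 : ℝ), (p.2 : V)))
      (by fun_prop) fun p => ⟨p.1.2, p.2.2⟩
  have hF' := continuous_projSet_family hS hT F hF fun _ c v w hc h => by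
    change f v.1 = c • f w.1
    rw [← h, hf_smul c hc _ w.2]
  have hG' := continuous_projSet_family hT hS G hG fun _ c v w hc h => by
    change g v.1 = c • g w.1
    rw [← h, hg_smul c hc _ w.2]
  have hK' := continuous_projSet_family hS hS K hK fun s c v w hc h => by
    change H (s, v.1) = c • H (s, w.1)
    rw [← h, hH_smul _ c hc _ w.2]
  let φ : C(projSet S, projSet T) :=
    ⟨fun x => coneProj hT (F () (lineRep x)), hF'.comp (Continuous.prodMk_right ())⟩
  let ψ : C(projSet T, projSet S) :=
    ⟨fun x => coneProj hS (G () (lineRep x)), hG'.comp (Continuous.prodMk_right ())⟩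
  have hψφ : ∀ x : projSet S, ψ (φ x) = coneProj hS (G () (F () (lineRep x))) := by
    intro x
    obtain ⟨c, hc, hrep⟩ := lineRep_coneProj hT (F () (lineRep x))
    refine coneProj_eq_of_smul hS (c := c) ?_
    change c • g (f (lineRep x).1) = g (lineRep (coneProj hT (F () (lineRep x)))).1
    rw [hrep, hg_smul c hc _ (F () (lineRep x)).2]
  have hφψ : ∀ x : projSet T, φ (ψ x) = x := by
    intro x
    conv_rhs => rw [← coneProj_lineRep hT x]
    obtain ⟨c, hc, hrep⟩ := lineRep_coneProj hS (G () (lineRep x))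
    refine coneProj_eq_of_smul hT (c := c) ?_
    change c • (lineRep x).1 = f (lineRep (coneProj hS (G () (lineRep x)))).1
    rw [hrep, hf_smul c hc _ (G () (lineRep x)).2]
    change c • (lineRep x).1 = c • f (g (lineRep x).1)
    rw [hfg _ (lineRep x).2]
  let e : ContinuousMap.HomotopyEquiv (projSet S) (projSet T) :=
    { toFun := φ
      invFun := ψ
      left_inv := by
        refine ⟨⟨⟨_, hK'⟩, fun x => ?_, fun x => ?_⟩⟩
        · change _ = ψ (φ x)
          rw [hψφ]
          exact congrArg (coneProj hS) (Subtype.ext (hH0 _ (lineRep x).2))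
        · change _ = x
          conv_rhs => rw [← coneProj_lineRep hS x]
          exact congrArg (coneProj hS) (Subtype.ext (hH1 _ (lineRep x).2))
      right_inv := by
        rw [show φ.comp ψ = ContinuousMap.id _ from ContinuousMap.ext hφψ] }
  exact ⟨fun h => h.of_homotopyEquiv e, fun h => h.of_homotopyEquiv e.symm⟩

/-- The affine chart `w ≠ 0` of the projectivization of a cone in `V × ℂ`. -/
lemma hasEulerChar_projSet_iff_of_chart {S : Set (V × ℂ)} (hS : IsComplexCone S)
    (hne : ∀ p ∈ S, p.2 ≠ 0) {k : ℤ} :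
    HasEulerChar (projSet S) k ↔ HasEulerChar {z : V | (z, (1 : ℂ)) ∈ S} k := by
  have hmem : ∀ p ∈ S, (p.2⁻¹ • p.1, (1 : ℂ)) ∈ S := by
    intro p hp
    have := hS.2 p.2⁻¹ (inv_ne_zero (hne p hp)) p hp
    rwa [show p.2⁻¹ • p = (p.2⁻¹ • p.1, (1 : ℂ)) from
      Prod.ext rfl (inv_mul_cancel₀ (hne p hp))] at this
  have hhom : ∀ (c : ℂ), c ≠ 0 → ∀ p : V × ℂ, (c • p).2⁻¹ • (c • p).1 = p.2⁻¹ • p.1 := by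
    intro c hc p
    change (c * p.2)⁻¹ • (c • p.1) = _
    rw [smul_smul, mul_inv, mul_assoc,
      mul_comm p.2⁻¹, ← mul_assoc, inv_mul_cancel₀ hc, one_mul]
  let φ : projSet S → {z : V | (z, (1 : ℂ)) ∈ S} := fun x => ⟨_, hmem _ (lineRep x).2⟩
  let ψ : {z : V | (z, (1 : ℂ)) ∈ S} → projSet S := fun z => coneProj hS ⟨(z.1, 1), z.2⟩
  have hφ : Continuous φ := by
    rw [← (isOpenQuotientMap_coneProj hS).continuous_comp_iff]
    have : φ ∘ coneProj hS = fun p : S => ⟨_, hmem p.1 p.2⟩ := by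
      ext1 p
      obtain ⟨c, hc, hrep⟩ := lineRep_coneProj hS p
      refine Subtype.ext ?_
      change (lineRep (coneProj hS p)).1.2⁻¹ • (lineRep (coneProj hS p)).1.1 = _
      rw [hrep, hhom c hc]
    rw [this]
    refine Continuous.subtype_mk ?_ _
    exact Continuous.smul (Continuous.inv₀ (by fun_prop) fun p => hne p.1 p.2) (by fun_prop)
  have hψ : Continuous ψ := (continuous_coneProj hS).comp (by fun_prop)
  have hψφ : ∀ x, ψ (φ x) = x := by
    intro x
    conv_rhs => rw [← coneProj_lineRep hS x]
    refine coneProj_eq_of_smul hS (c := (lineRep x).1.2⁻¹) ?_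
    exact Prod.ext rfl (inv_mul_cancel₀ (hne _ (lineRep x).2))
  have hφψ : ∀ z, φ (ψ z) = z := by
    intro z
    obtain ⟨c, hc, hrep⟩ := lineRep_coneProj hS ⟨(z.1, 1), z.2⟩
    refine Subtype.ext ?_
    change (lineRep (coneProj hS ⟨(z.1, 1), z.2⟩)).1.2⁻¹ •
      (lineRep (coneProj hS ⟨(z.1, 1), z.2⟩)).1.1 = z.1
    rw [hrep, hhom c hc, inv_one, one_smul]
  let e : projSet S ≃ₜ {z : V | (z, (1 : ℂ)) ∈ S} := Homeomorph.mk ⟨φ, ψ, hψφ, hφψ⟩ hφ hψ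
  exact ⟨fun h => h.of_homeomorph e, fun h => h.of_homeomorph e.symm⟩

lemma hasConeEulerChar_iff_of_deformation (hS : IsComplexCone S) (hT : IsComplexCone T)
    (f : V → W) (g : W → V) (H : ℝ × V → V)
    (hf : ContinuousOn f S) (hfST : ∀ a ∈ S, f a ∈ T) (hg : ContinuousOn g T)
    (hgTS : ∀ b ∈ T, g b ∈ S) (hfg : ∀ b ∈ T, f (g b) = b)
    (hH : ContinuousOn H (Set.Icc 0 1 ×ˢ S)) (hHS : ∀ s ∈ Set.Icc (0 : ℝ) 1, ∀ a ∈ S, H (s, a) ∈ S)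
    (hH0 : ∀ a ∈ S, H (0, a) = g (f a)) (hH1 : ∀ a ∈ S, H (1, a) = a)
    (hf_smul : ∀ (c : ℂ), c ≠ 0 → ∀ v ∈ S, f (c • v) = c • f v)
    (hg_smul : ∀ (c : ℂ), c ≠ 0 → ∀ v ∈ T, g (c • v) = c • g v)
    (hH_smul : ∀ s (c : ℂ), c ≠ 0 → ∀ v ∈ S, H (s, c • v) = c • H (s, v)) {k : ℤ} :
    HasConeEulerChar S k ↔ HasConeEulerChar T k :=
  and_congr (iff_of_true hS hT) (and_congr
    (hasEulerChar_iff_of_deformation f g H hf hfST hg hgTS hfg hH hHS hH0 hH1)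
    (hasEulerChar_projSet_iff_of_deformation hS hT f g H hf hfST hg hgTS hfg hH hHS hH0 hH1
      hf_smul hg_smul hH_smul))

/-- Invariance under linear isomorphisms. -/
lemma HasConeEulerChar.of_linearEquiv (e : W ≃L[ℂ] V) {k : ℤ} (h : HasConeEulerChar S k) :
    HasConeEulerChar (e ⁻¹' S) k := by
  refine (hasConeEulerChar_iff_of_deformation (S := S) (T := e ⁻¹' S) h.1
    ⟨fun h0 => h.1.1 (by simpa using h0), fun c hc v hv => ?_⟩ e.symm e Prod.snd
    e.symm.continuous.continuousOn (fun a ha => by simpa using ha)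
    e.continuous.continuousOn (fun b hb => hb) (fun b _ => by simp) continuousOn_snd
    (fun _ _ _ h => h) (fun a _ => by simp) (fun _ _ => rfl) (fun _ _ _ _ => by simp)
    (fun _ _ _ _ => by simp) (fun _ _ _ _ _ => rfl)).mp h
  rw [Set.mem_preimage, map_smul]
  exact h.1.2 c hc _ hv

/-- Adding one coordinate `w` to a cone `S`. The part of `S'` over the open set `U` is `S × ℂ`,
which retracts to `S`; the part `w ≠ 0` is a product of its slice `w = 1` with `ℂ ∖ {0}`; and the
two parts meet in `S × (ℂ ∖ {0})`. -/
lemma HasConeEulerChar.of_add_coordinate {k d : ℤ} (h : HasConeEulerChar S k) {S' : Set (V × ℂ)}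
    (hS' : IsComplexCone S') {U : Set V} (hUo : IsOpen U) (hUc : IsComplexCone U)
    (hU : ∀ z w, (z, w) ∈ S' ∧ z ∈ U ↔ z ∈ S) (h0 : ∀ z, (z, (0 : ℂ)) ∈ S' → z ∈ U)
    (hD : HasEulerChar {z : V | (z, (1 : ℂ)) ∈ S'} d) : HasConeEulerChar S' (k + d) := by
  obtain ⟨hS, hS0, hSk⟩ := h
  let A : Set (V × ℂ) := Prod.fst ⁻¹' U
  let B : Set (V × ℂ) := {p | p.2 ≠ 0}
  have hA : IsComplexCone A := ⟨hUc.1, fun c hc v hv => hUc.2 c hc _ hv⟩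
  have hB : IsComplexCone B := ⟨fun h => h rfl, fun c hc v hv => mul_ne_zero hc hv⟩
  have hAo : IsOpen A := hUo.preimage continuous_fst
  have hBo : IsOpen B := isOpen_ne_fun continuous_snd continuous_const
  have hcover : ∀ p ∈ S', p ∈ A ∪ B := by
    rintro ⟨z, w⟩ hp
    by_cases hw : w = 0
    · subst hw
      exact Or.inl (h0 z hp)
    · exact Or.inr hw
  have hSA : HasConeEulerChar (S' ∩ A) k := by
    refine (hasConeEulerChar_iff_of_deformation (T := S) (hS'.inter hA) hS Prod.fst
      (fun z => (z, 0)) (fun p => (p.2.1, (p.1 : ℂ) * p.2.2)) (by fun_prop)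
      (fun p hp => (hU p.1 p.2).mp hp) (by fun_prop) (fun z hz => (hU z 0).mpr hz)
      (fun _ _ => rfl) (by fun_prop)
      (fun s _ p hp => (hU _ _).mpr ((hU p.1 p.2).mp hp)) (fun _ _ => by simp)
      (fun _ _ => by simp) (fun _ _ _ _ => rfl) (fun _ _ _ _ => ?_)
      (fun _ _ _ _ _ => ?_)).mpr ⟨hS, hS0, hSk⟩
    · simp
    · exact Prod.ext rfl (mul_left_comm _ _ _)
  refine ⟨hS', ?_, ?_⟩
  · have hSB : HasEulerChar ↥(S' ∩ B) 0 := by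
      refine (hasEulerChar_iff_of_inverse
        (T := {p : V × ℂ | p.1 ∈ {z : V | (z, (1 : ℂ)) ∈ S'} ∧ p.2 ≠ 0})
        (fun p => (p.2⁻¹ • p.1, p.2)) (fun p => (p.2 • p.1, p.2)) ?_ (fun p hp => ?_)
        (by fun_prop) (fun p hp => ?_) (fun p hp => ?_) (fun p hp => ?_)).mpr
        hD.prod_complex_ne_zero
      · exact ((continuousOn_snd.inv₀ fun p hp => hp.2).smul continuousOn_fst).prodMk
          continuousOn_snd
      · refine ⟨?_, hp.2⟩
        have := hS'.2 p.2⁻¹ (inv_ne_zero hp.2) p hp.1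
        rwa [show p.2⁻¹ • p = (p.2⁻¹ • p.1, (1 : ℂ)) from
          Prod.ext rfl (inv_mul_cancel₀ hp.2)] at this
      · refine ⟨?_, hp.2⟩
        have := hS'.2 p.2 hp.2 _ hp.1
        rwa [show p.2 • (p.1, (1 : ℂ)) = (p.2 • p.1, p.2) from
          Prod.ext rfl (mul_one _)] at this
      · exact Prod.ext (inv_smul_smul₀ hp.2 _) rfl
      · exact Prod.ext (smul_inv_smul₀ hp.2 _) rfl
    have hSAB : HasEulerChar ↥(S' ∩ (A ∩ B)) 0 := by
      have : S' ∩ (A ∩ B) = {p : V × ℂ | p.1 ∈ S ∧ p.2 ≠ 0} := by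
        ext p
        rw [← Set.inter_assoc]
        exact and_congr (hU p.1 p.2) Iff.rfl
      rw [this]
      exact hS0.prod_complex_ne_zero
    exact (HasEulerChar.of_subset_cover hAo hBo hcover hSA.2.1 hSB hSAB).congr (by ring)
  · have hSB : HasEulerChar ↥(projSet (S' ∩ B)) d := by
      rw [hasEulerChar_projSet_iff_of_chart (hS'.inter hB) fun p hp => hp.2]
      have : {z : V | (z, (1 : ℂ)) ∈ S' ∩ B} = {z : V | (z, (1 : ℂ)) ∈ S'} := by
        ext z
        exact and_iff_left one_ne_zero
      rwa [this]
    have hSAB : HasEulerChar ↥(projSet (S' ∩ (A ∩ B))) 0 := by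
      rw [hasEulerChar_projSet_iff_of_chart (hS'.inter (hA.inter hB)) fun p hp => hp.2.2]
      have : {z : V | (z, (1 : ℂ)) ∈ S' ∩ (A ∩ B)} = S := by
        ext z
        rw [← Set.inter_assoc]
        exact (and_iff_left one_ne_zero).trans (hU z 1)
      rwa [this]
    exact (HasEulerChar.of_subset_cover (T := projSet S') (isOpen_projSet hA hAo)
      (isOpen_projSet hB hBo) (fun x hx => hcover _ hx) hSA.2.2 hSB hSAB).congr (by ring)

end ConeDeformation

/-! ### Quadrics given by sums of squares -/

section SumOfSquares

variable {r t : ℕ}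

/-- The sum of squares of the coordinates. -/
def sumSq (z : Fin r → ℂ) : ℂ := ∑ i, z i ^ 2

/-- The square of the Hermitian norm. -/
noncomputable def hermSq (z : Fin r → ℂ) : ℝ := ∑ i, ‖z i‖ ^ 2

/-- The cone over the complement of real projective space in complex projective space: by the
equality case of the triangle inequality, `‖∑ zᵢ²‖ < ∑ ‖zᵢ‖²` says that `z` is not a multiple of a
real vector. -/
def nonrealCone (r : ℕ) : Set (Fin r → ℂ) := {z | ‖sumSq z‖ < hermSq z}

lemma continuous_sumSq : Continuous (sumSq (r := r)) := by
  unfold sumSq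
  fun_prop

lemma continuous_hermSq : Continuous (hermSq (r := r)) := by
  unfold hermSq
  fun_prop

lemma isOpen_nonrealCone : IsOpen (nonrealCone r) :=
  isOpen_lt continuous_sumSq.norm continuous_hermSq

lemma sumSq_smul (c : ℂ) (z : Fin r → ℂ) : sumSq (c • z) = c ^ 2 * sumSq z := by
  simp [sumSq, Finset.mul_sum, mul_pow]

lemma hermSq_smul (c : ℂ) (z : Fin r → ℂ) : hermSq (c • z) = ‖c‖ ^ 2 * hermSq z := by
  simp [hermSq, Finset.mul_sum, mul_pow]

lemma hermSq_nonneg (z : Fin r → ℂ) : 0 ≤ hermSq z :=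
  Finset.sum_nonneg fun _ _ => sq_nonneg _

lemma norm_sumSq_le (z : Fin r → ℂ) : ‖sumSq z‖ ≤ hermSq z :=
  (norm_sum_le _ _).trans (Finset.sum_le_sum fun i _ => (norm_pow (z i) 2).le)

lemma isComplexCone_nonrealCone : IsComplexCone (nonrealCone r) := by
  refine ⟨fun h => ?_, fun c hc z hz => ?_⟩
  · have h' : ‖sumSq (0 : Fin r → ℂ)‖ < hermSq (0 : Fin r → ℂ) := h
    simp [sumSq, hermSq] at h'
  · change ‖sumSq (c • z)‖ < hermSq (c • z)
    rw [sumSq_smul, hermSq_smul, norm_mul, norm_pow]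
    exact mul_lt_mul_of_pos_left hz (by positivity)

/-- Non-real vectors retract to their imaginary parts. -/
lemma hasEulerChar_nonreal (r : ℕ) :
    HasEulerChar {z : Fin r → ℂ | ∃ i, (z i).im ≠ 0} (1 - (-1) ^ r) := by
  refine (hasEulerChar_iff_of_deformation (T := {v : Fin r → ℝ | v ≠ 0})
    (fun z i => (z i).im) (fun v i => (v i : ℂ) * Complex.I)
    (fun p i => (p.1 * (p.2 i).re : ℂ) + (p.2 i).im * Complex.I) (by fun_prop) ?_ (by fun_prop)
    ?_ ?_ (by fun_prop) ?_ ?_ ?_).mpr (hasEulerChar_punctured r)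
  · rintro z ⟨i, hi⟩ h
    exact hi (congrFun h i)
  · intro v hv
    obtain ⟨i, hi⟩ := Function.ne_iff.mp hv
    exact ⟨i, by simpa using hi⟩
  · intro v _
    ext i
    simp
  · rintro s - z ⟨i, hi⟩
    exact ⟨i, by simpa using hi⟩
  · intro z _
    ext i
    simp
  · intro z _
    ext i
    simp

lemma norm_sq_add_one_lt {z : ℂ} (hz : z.im ≠ 0) : ‖z ^ 2 + 1‖ < ‖z‖ ^ 2 + 1 := by
  refine lt_of_pow_lt_pow_left₀ 2 (by positivity) ?_
  rw [← Complex.normSq_eq_norm_sq, ← Complex.normSq_eq_norm_sq, Complex.normSq_apply,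
    Complex.normSq_apply]
  have h : 0 < z.im ^ 2 := by positivity
  simp only [pow_two, Complex.add_re, Complex.add_im, Complex.mul_re, Complex.mul_im,
    Complex.one_re, Complex.one_im]
  nlinarith [h]

/-- The slice `w = 1` of the nonreal cone in one more coordinate `w` consists of the nonreal
vectors. -/
lemma norm_sumSq_add_one_lt_iff (z : Fin r → ℂ) :
    ‖sumSq z + 1‖ < hermSq z + 1 ↔ ∃ i, (z i).im ≠ 0 := by
  constructor
  · intro h
    by_contra! hcon
    have hz : ∀ i, z i = ((z i).re : ℂ) := fun i => Complex.ext rfl (by simp [hcon i])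
    have h1 : sumSq z = (hermSq z : ℂ) := by
      rw [sumSq, hermSq]
      push_cast
      refine Finset.sum_congr rfl fun i _ => ?_
      rw [hz i, Complex.norm_real, ← Complex.ofReal_pow, ← Complex.ofReal_pow, Real.norm_eq_abs,
        sq_abs]
    rw [h1, ← Complex.ofReal_one, ← Complex.ofReal_add, Complex.norm_real, Real.norm_of_nonneg
      (by have := hermSq_nonneg z; positivity)] at h
    exact lt_irrefl _ h
  · rintro ⟨i, hi⟩
    have h1 : sumSq z = z i ^ 2 + ∑ j ∈ Finset.univ.erase i, z j ^ 2 :=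
      (Finset.add_sum_erase _ _ (Finset.mem_univ i)).symm
    have h2 : hermSq z = ‖z i‖ ^ 2 + ∑ j ∈ Finset.univ.erase i, ‖z j‖ ^ 2 :=
      (Finset.add_sum_erase _ _ (Finset.mem_univ i)).symm
    have h3 : ‖∑ j ∈ Finset.univ.erase i, z j ^ 2‖ ≤ ∑ j ∈ Finset.univ.erase i, ‖z j‖ ^ 2 :=
      (norm_sum_le _ _).trans (Finset.sum_le_sum fun i _ => (norm_pow (z i) 2).le)
    calc ‖sumSq z + 1‖ = ‖(z i ^ 2 + 1) + ∑ j ∈ Finset.univ.erase i, z j ^ 2‖ := by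
          rw [h1]; congr 1; ring
      _ ≤ ‖z i ^ 2 + 1‖ + ‖∑ j ∈ Finset.univ.erase i, z j ^ 2‖ := norm_add_le _ _
      _ < hermSq z + 1 := by
          have := norm_sq_add_one_lt hi
          rw [h2]
          linarith

/-- Splitting off the first coordinate. -/
noncomputable def splitFirst (r : ℕ) : (Fin (r + 1) → ℂ) ≃L[ℂ] (Fin r → ℂ) × ℂ :=
  (Fin.consEquivL ℂ fun _ : Fin (r + 1) => ℂ).symm.trans (ContinuousLinearEquiv.prodComm ℂ _ _)

/-- The complement of real projective space in complex projective space, by adding one coordinate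
at a time. -/
lemma hasConeEulerChar_nonrealCone (r : ℕ) :
    HasConeEulerChar (nonrealCone r) (if Even r then (r : ℤ) else r - 1) := by
  induction r with
  | zero =>
    have : nonrealCone 0 = ∅ := Set.eq_empty_of_forall_notMem fun z hz =>
      isComplexCone_nonrealCone.1 (Subsingleton.elim z 0 ▸ hz)
    rw [this]
    simpa using hasConeEulerChar_empty
  | succ r ih =>
    let S' : Set ((Fin r → ℂ) × ℂ) := {p | ‖sumSq p.1 + p.2 ^ 2‖ < hermSq p.1 + ‖p.2‖ ^ 2}
    have hS'eq : ∀ z, splitFirst r z ∈ S' ↔ z ∈ nonrealCone (r + 1) := by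
      intro z
      change ‖sumSq (Fin.tail z) + z 0 ^ 2‖ < hermSq (Fin.tail z) + ‖z 0‖ ^ 2 ↔
        ‖sumSq z‖ < hermSq z
      rw [sumSq, hermSq, sumSq, hermSq, Fin.sum_univ_succ, Fin.sum_univ_succ,
        add_comm (z 0 ^ 2), add_comm (‖z 0‖ ^ 2)]
      rfl
    have hS' : IsComplexCone S' := by
      refine ⟨fun h => isComplexCone_nonrealCone.1 ((hS'eq 0).mp (by rwa [map_zero])),
        fun c hc p hp => ?_⟩
      have h1 := isComplexCone_nonrealCone.2 c hc ((splitFirst r).symm p)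
        ((hS'eq _).mp (by rwa [ContinuousLinearEquiv.apply_symm_apply]))
      have h2 := (hS'eq _).mpr h1
      rwa [map_smul, ContinuousLinearEquiv.apply_symm_apply] at h2
    have hD : HasEulerChar {z : Fin r → ℂ | (z, (1 : ℂ)) ∈ S'} (1 - (-1) ^ r) := by
      have : {z : Fin r → ℂ | (z, (1 : ℂ)) ∈ S'} = {z | ∃ i, (z i).im ≠ 0} := by
        ext z
        change ‖sumSq z + 1 ^ 2‖ < hermSq z + ‖(1 : ℂ)‖ ^ 2 ↔ _
        rw [one_pow, norm_one, one_pow]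
        exact norm_sumSq_add_one_lt_iff z
      rw [this]
      exact hasEulerChar_nonreal r
    have key := (ih.of_add_coordinate hS' isOpen_nonrealCone isComplexCone_nonrealCone
      (fun z w => ?_) (fun z hz => ?_) hD).of_linearEquiv (splitFirst r)
    · have : splitFirst r ⁻¹' S' = nonrealCone (r + 1) := Set.ext hS'eq
      rw [this] at key
      refine key.congr ?_
      rcases Nat.even_or_odd r with h | h
      · rw [if_pos h, if_neg (by rw [Nat.even_add_one, not_not]; exact h), h.neg_one_pow]
        push_cast
        ring
      · rw [if_neg (Nat.not_even_iff_odd.mpr h),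
          if_pos (by rw [Nat.even_add_one]; exact Nat.not_even_iff_odd.mpr h), h.neg_one_pow]
        push_cast
        ring
    · refine ⟨fun h => h.2, fun h => ⟨?_, h⟩⟩
      change ‖sumSq z + w ^ 2‖ < hermSq z + ‖w‖ ^ 2
      have h' : ‖sumSq z‖ < hermSq z := h
      have := norm_add_le (sumSq z) (w ^ 2)
      rw [norm_pow] at this
      linarith
    · have h' : ‖sumSq z + 0 ^ 2‖ < hermSq z + ‖(0 : ℂ)‖ ^ 2 := hz
      rw [norm_zero, zero_pow two_ne_zero, zero_pow two_ne_zero, add_zero, add_zero] at h'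
      exact h'

/-- The cone over the smooth quadric `∑ zᵢ² = 0`. -/
def isotropicCone (r : ℕ) : Set (Fin r → ℂ) := {z | z ≠ 0 ∧ sumSq z = 0}

lemma isComplexCone_isotropicCone : IsComplexCone (isotropicCone r) :=
  ⟨fun h => h.1 rfl, fun c hc z hz => ⟨smul_ne_zero hc hz.1, by rw [sumSq_smul, hz.2, mul_zero]⟩⟩

lemma hermSq_pos {z : Fin r → ℂ} (hz : z ≠ 0) : 0 < hermSq z := by
  obtain ⟨i, hi⟩ := Function.ne_iff.mp hz
  refine Finset.sum_pos' (fun _ _ => sq_nonneg _) ⟨i, Finset.mem_univ i, ?_⟩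
  have : 0 < ‖z i‖ := norm_pos_iff.mpr hi
  positivity

lemma isotropicCone_subset_nonrealCone : isotropicCone r ⊆ nonrealCone r := by
  intro z hz
  change ‖sumSq z‖ < hermSq z
  rw [hz.2, norm_zero]
  exact hermSq_pos hz.1

/-- The vector `z + γ z̄`. -/
noncomputable def addConj (γ : ℂ) (z : Fin r → ℂ) : Fin r → ℂ :=
  fun i => z i + γ * (starRingEnd ℂ) (z i)

lemma sumSq_addConj (γ : ℂ) (z : Fin r → ℂ) :
    sumSq (addConj γ z) =
      sumSq z + 2 * γ * hermSq z + γ ^ 2 * (starRingEnd ℂ) (sumSq z) := by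
  simp only [sumSq, hermSq, addConj, map_sum, map_pow, Complex.ofReal_sum, Complex.ofReal_pow,
    Finset.mul_sum, ← Finset.sum_add_distrib]
  refine Finset.sum_congr rfl fun i _ => ?_
  rw [← Complex.mul_conj']
  ring

lemma hermSq_addConj (γ : ℂ) (z : Fin r → ℂ) :
    hermSq (addConj γ z) =
      (1 + ‖γ‖ ^ 2) * hermSq z + 2 * (γ * (starRingEnd ℂ) (sumSq z)).re := by
  simp only [sumSq, hermSq, addConj, map_sum, map_pow, Finset.mul_sum, Complex.re_sum,
    ← Finset.sum_add_distrib]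
  refine Finset.sum_congr rfl fun i _ => ?_
  simp only [← Complex.normSq_eq_norm_sq]
  simp only [Complex.normSq_apply, Complex.add_re, Complex.add_im, Complex.mul_re, Complex.mul_im,
    Complex.conj_re, Complex.conj_im, pow_two]
  ring

/-- The plane spanned over `ℝ` by the real and imaginary parts of `z` does not change under
`z ↦ z + γ z̄` if `‖γ‖ < 1`. -/
lemma addConj_mem_nonrealCone {γ : ℂ} (hγ : ‖γ‖ < 1) {z : Fin r → ℂ} (hz : z ∈ nonrealCone r) :
    addConj γ z ∈ nonrealCone r := by
  have hz' : ‖sumSq z‖ < hermSq z := hz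
  have h1 : hermSq (addConj γ z) ^ 2 - ‖sumSq (addConj γ z)‖ ^ 2 =
      (1 - ‖γ‖ ^ 2) ^ 2 * (hermSq z ^ 2 - ‖sumSq z‖ ^ 2) := by
    rw [hermSq_addConj, sumSq_addConj]
    simp only [← Complex.normSq_eq_norm_sq]
    simp only [Complex.normSq_apply, Complex.add_re, Complex.add_im, Complex.mul_re,
      Complex.mul_im, Complex.conj_re, Complex.conj_im, pow_two, Complex.ofReal_re,
      Complex.ofReal_im, Complex.re_ofNat, Complex.im_ofNat]
    ring
  have h2 : 0 < hermSq z ^ 2 - ‖sumSq z‖ ^ 2 := by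
    have := pow_lt_pow_left₀ hz' (norm_nonneg _) two_ne_zero
    linarith
  have h3 : 0 < 1 - ‖γ‖ ^ 2 := by
    have := pow_lt_one₀ (norm_nonneg γ) hγ two_ne_zero
    linarith
  have h4 : 0 < (1 - ‖γ‖ ^ 2) ^ 2 * (hermSq z ^ 2 - ‖sumSq z‖ ^ 2) := by positivity
  exact lt_of_pow_lt_pow_left₀ 2 (hermSq_nonneg _) (by linarith)

/-- The positive number `h + √(h² - ‖q‖²)` for `h = ∑ ‖zᵢ‖²` and `q = ∑ zᵢ²`. -/
noncomputable def retractionDenom (z : Fin r → ℂ) : ℝ :=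
  hermSq z + √(hermSq z ^ 2 - ‖sumSq z‖ ^ 2)

/-- The root `γ` of `q + 2 γ h + γ² q̄` of absolute value less than `1`. Adding `γ z̄` to `z` makes
`z` isotropic. -/
noncomputable def retractionCoeff (z : Fin r → ℂ) : ℂ := -sumSq z / retractionDenom z

lemma retractionDenom_pos {z : Fin r → ℂ} (hz : z ∈ nonrealCone r) : 0 < retractionDenom z :=
  add_pos_of_pos_of_nonneg ((norm_nonneg _).trans_lt hz) (Real.sqrt_nonneg _)

lemma norm_retractionCoeff_lt {z : Fin r → ℂ} (hz : z ∈ nonrealCone r) :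
    ‖retractionCoeff z‖ < 1 := by
  have h := retractionDenom_pos hz
  rw [retractionCoeff, norm_div, norm_neg, Complex.norm_real, Real.norm_of_nonneg h.le,
    div_lt_one h]
  have hz' : ‖sumSq z‖ < hermSq z := hz
  exact hz'.trans_le (le_add_of_nonneg_right (Real.sqrt_nonneg _))

lemma sumSq_addConj_retractionCoeff {z : Fin r → ℂ} (hz : z ∈ nonrealCone r) :
    sumSq (addConj (retractionCoeff z) z) = 0 := by
  have hD := retractionDenom_pos hz
  have hD' : (retractionDenom z : ℂ) ≠ 0 := Complex.ofReal_ne_zero.mpr hD.ne'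
  have h2 : 0 ≤ hermSq z ^ 2 - ‖sumSq z‖ ^ 2 := by
    have := pow_le_pow_left₀ (norm_nonneg _) (norm_sumSq_le z) 2
    linarith
  have hquad : retractionDenom z ^ 2 - 2 * hermSq z * retractionDenom z + ‖sumSq z‖ ^ 2 = 0 := by
    have := Real.sq_sqrt h2
    rw [retractionDenom]
    linear_combination this
  have hquad' : (retractionDenom z : ℂ) ^ 2 - 2 * hermSq z * retractionDenom z +
      sumSq z * (starRingEnd ℂ) (sumSq z) = 0 := by
    rw [Complex.mul_conj']
    exact_mod_cast congrArg (fun x : ℝ => (x : ℂ)) hquad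
  rw [sumSq_addConj, retractionCoeff]
  field_simp
  linear_combination sumSq z * hquad'

lemma retractionDenom_smul (c : ℂ) (z : Fin r → ℂ) :
    retractionDenom (c • z) = ‖c‖ ^ 2 * retractionDenom z := by
  rw [retractionDenom, retractionDenom, sumSq_smul, hermSq_smul, norm_mul, norm_pow]
  have : (‖c‖ ^ 2 * hermSq z) ^ 2 - (‖c‖ ^ 2 * ‖sumSq z‖) ^ 2 =
      (‖c‖ ^ 2) ^ 2 * (hermSq z ^ 2 - ‖sumSq z‖ ^ 2) := by ring
  rw [this, Real.sqrt_mul (by positivity), Real.sqrt_sq (by positivity)]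
  ring

lemma addConj_retractionCoeff_smul (s : ℂ) {c : ℂ} (hc : c ≠ 0) {z : Fin r → ℂ}
    (hz : z ∈ nonrealCone r) :
    addConj (s * retractionCoeff (c • z)) (c • z) = c • addConj (s * retractionCoeff z) z := by
  have hD : (retractionDenom z : ℂ) ≠ 0 := Complex.ofReal_ne_zero.mpr (retractionDenom_pos hz).ne'
  have hc' : (starRingEnd ℂ) c ≠ 0 := (map_ne_zero _).mpr hc
  ext i
  simp only [addConj, Pi.smul_apply, smul_eq_mul, map_mul, retractionCoeff, retractionDenom_smul,
    sumSq_smul, Complex.ofReal_mul, Complex.ofReal_pow]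
  rw [← Complex.mul_conj']
  field_simp

lemma continuousOn_retractionCoeff : ContinuousOn (retractionCoeff (r := r)) (nonrealCone r) := by
  refine ContinuousOn.div continuous_sumSq.neg.continuousOn ?_ fun z hz =>
    Complex.ofReal_ne_zero.mpr (retractionDenom_pos hz).ne'
  refine (Complex.continuous_ofReal.comp ?_).continuousOn
  exact continuous_hermSq.add
    (((continuous_hermSq.pow 2).sub (continuous_sumSq.norm.pow 2)).sqrt)

/-- The complement of real projective space retracts onto the smooth quadric. -/
lemma hasConeEulerChar_isotropicCone (r : ℕ) :
    HasConeEulerChar (isotropicCone r) (if Even r then (r : ℤ) else r - 1) := by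
  have hcont : ContinuousOn (fun p : ℝ × (Fin r → ℂ) =>
      addConj (((1 - p.1 : ℝ) : ℂ) * retractionCoeff p.2) p.2) (Set.univ ×ˢ nonrealCone r) := by
    refine continuousOn_pi.mpr fun i => ?_
    have h1 : ContinuousOn (fun p : ℝ × (Fin r → ℂ) => retractionCoeff p.2)
        (Set.univ ×ˢ nonrealCone r) :=
      continuousOn_retractionCoeff.comp continuousOn_snd fun p hp => hp.2
    unfold addConj
    fun_prop
  refine (hasConeEulerChar_iff_of_deformation (S := nonrealCone r) isComplexCone_nonrealCone
    isComplexCone_isotropicCone (fun z => addConj (retractionCoeff z) z) id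
    (fun p => addConj (((1 - p.1 : ℝ) : ℂ) * retractionCoeff p.2) p.2) ?_ ?_ continuousOn_id
    (fun z hz => isotropicCone_subset_nonrealCone hz) ?_ (hcont.mono ?_) ?_ ?_ ?_ ?_ ?_ ?_).mp
    (hasConeEulerChar_nonrealCone r)
  · have := hcont.comp (f := fun z => ((0 : ℝ), z)) (s := nonrealCone r) (by fun_prop)
      fun z hz => ⟨Set.mem_univ _, hz⟩
    simpa [Function.comp_def] using this
  · intro z hz
    refine ⟨?_, sumSq_addConj_retractionCoeff hz⟩
    exact isComplexCone_nonrealCone.ne_zero (addConj_mem_nonrealCone (norm_retractionCoeff_lt hz) hz)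
  · intro z hz
    ext i
    simp [addConj, retractionCoeff, hz.2]
  · exact Set.prod_mono (Set.subset_univ _) subset_rfl
  · intro s hs z hz
    refine addConj_mem_nonrealCone ?_ hz
    rw [norm_mul, Complex.norm_real, Real.norm_of_nonneg (by linarith [hs.2])]
    refine lt_of_le_of_lt ?_ (norm_retractionCoeff_lt hz)
    exact mul_le_of_le_one_left (norm_nonneg _) (by linarith [hs.1])
  · intro z _
    simp
  · intro z _
    ext i
    simp [addConj]
  · intro c hc z hz
    simpa using addConj_retractionCoeff_smul 1 hc hz
  · intro c _ z _
    rfl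
  · intro s c hc z hz
    exact addConj_retractionCoeff_smul _ hc hz

/-- The cone over the quadric `∑ zᵢ² = 0` in the space with coordinates `z₁, …, zᵣ, u₁, …, uₜ`. -/
def singularIsotropicCone (r t : ℕ) : Set ((Fin r → ℂ) × (Fin t → ℂ)) :=
  {p | p ≠ 0 ∧ sumSq p.1 = 0}

/-- Splitting off the first of the coordinates that do not occur in the quadratic form. -/
noncomputable def splitKernelCoordinate (r t : ℕ) :
    ((Fin r → ℂ) × (Fin (t + 1) → ℂ)) ≃L[ℂ] ((Fin r → ℂ) × (Fin t → ℂ)) × ℂ :=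
  ((ContinuousLinearEquiv.refl ℂ (Fin r → ℂ)).prodCongr (splitFirst t)).trans
    (ContinuousLinearEquiv.prodAssoc ℂ _ _ _).symm

/-- An affine quadratic cone contracts to its vertex. -/
lemma hasEulerChar_sumSq_eq_zero (r t : ℕ) :
    HasEulerChar {p : (Fin r → ℂ) × (Fin t → ℂ) | sumSq p.1 = 0} 1 := by
  refine (hasEulerChar_iff_of_deformation
    (S := {p : (Fin r → ℂ) × (Fin t → ℂ) | sumSq p.1 = 0}) (T := (Set.univ : Set Unit))
    (fun _ => ()) (fun _ => (0 : (Fin r → ℂ) × (Fin t → ℂ))) (fun p => p.1 • p.2) ?_ ?_ ?_ ?_ ?_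
    ?_ ?_ ?_ ?_).mpr (hasEulerChar_unit.of_homeomorph (Homeomorph.Set.univ Unit).symm)
  · fun_prop
  · exact fun _ _ => trivial
  · fun_prop
  · intro _ _
    change sumSq (0 : Fin r → ℂ) = 0
    simp [sumSq]
  · exact fun _ _ => rfl
  · fun_prop
  · intro s _ p hp
    have h1 : sumSq p.1 = 0 := hp
    change sumSq (s • p.1) = 0
    rw [← Complex.coe_smul, sumSq_smul, h1, mul_zero]
  · exact fun _ _ => zero_smul _ _
  · exact fun _ _ => one_smul _ _

/-- Each coordinate `w` that does not occur in the form adds the affine quadratic cone `w = 1`, which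
is contractible, and hence adds `1` to the Euler characteristic. -/
lemma hasConeEulerChar_singularIsotropicCone (r t : ℕ) :
    HasConeEulerChar (singularIsotropicCone r t) ((if Even r then (r : ℤ) else r - 1) + t) := by
  induction t with
  | zero =>
    have h := (hasConeEulerChar_isotropicCone r).of_linearEquiv
      (ContinuousLinearEquiv.prodUnique ℂ (Fin r → ℂ) (Fin 0 → ℂ))
    have : ContinuousLinearEquiv.prodUnique ℂ (Fin r → ℂ) (Fin 0 → ℂ) ⁻¹' isotropicCone r =
        singularIsotropicCone r 0 := by
      ext p
      refine and_congr (not_congr ?_) Iff.rfl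
      exact ⟨fun h => Prod.ext h (Subsingleton.elim _ _), fun h => congrArg Prod.fst h⟩
    rw [this] at h
    exact h.congr (by simp)
  | succ t ih =>
    let S' : Set (((Fin r → ℂ) × (Fin t → ℂ)) × ℂ) := {p | p ≠ 0 ∧ sumSq p.1.1 = 0}
    have hS' : IsComplexCone S' := ⟨fun h => h.1 rfl, fun c hc z hz => ⟨smul_ne_zero hc hz.1, by
      rw [Prod.smul_fst, Prod.smul_fst, sumSq_smul, hz.2, mul_zero]⟩⟩
    have hD : HasEulerChar {p : (Fin r → ℂ) × (Fin t → ℂ) | (p, (1 : ℂ)) ∈ S'} 1 := by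
      have : {p : (Fin r → ℂ) × (Fin t → ℂ) | (p, (1 : ℂ)) ∈ S'} = {p | sumSq p.1 = 0} :=
        Set.ext fun p => ⟨fun h => h.2, fun h => ⟨fun h0 => one_ne_zero (congrArg Prod.snd h0), h⟩⟩
      rw [this]
      exact hasEulerChar_sumSq_eq_zero r t
    have key := (ih.of_add_coordinate hS' (U := {p | p ≠ 0}) isOpen_ne
      ⟨fun h => h rfl, fun c hc p hp => smul_ne_zero hc hp⟩ (fun p w => ?_) (fun p hp => ?_)
      hD).of_linearEquiv (splitKernelCoordinate r t)
    · have : splitKernelCoordinate r t ⁻¹' S' = singularIsotropicCone r (t + 1) := by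
        ext p
        refine and_congr (not_congr ?_) Iff.rfl
        exact map_eq_zero_iff _ (splitKernelCoordinate r t).injective
      rw [this] at key
      exact key.congr (by push_cast; ring)
    · exact ⟨fun h => ⟨h.2, h.1.2⟩, fun h => ⟨⟨fun h0 => h.1 (congrArg Prod.fst h0), h.2⟩, h.1⟩⟩
    · rintro rfl
      exact hp.1 rfl

end SumOfSquares

/-! ### Diagonalization and conclusion -/

section QuadraticForms

variable {V : Type*} [AddCommGroup V] [Module ℂ V]

/-- On a complement of the radical, the form is nondegenerate, hence a sum of squares in suitable
coordinates, since `ℂ` is algebraically closed. -/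
lemma exists_linearEquiv_sumSq [Module.Finite ℂ V] (q : QuadraticForm ℂ V) {t : ℕ}
    (hrank : quadraticFormRank q + t = Module.finrank ℂ V) :
    ∃ e : V ≃ₗ[ℂ] (Fin (quadraticFormRank q) → ℂ) × (Fin t → ℂ), ∀ v, q v = sumSq (e v).1 := by
  set B := QuadraticMap.associated q
  obtain ⟨W, hW⟩ := Submodule.exists_isCompl (LinearMap.ker B)
  have hself : ∀ v, B v v = q v := fun v => QuadraticMap.associated_eq_self_apply ℂ q v
  have hsymm : ∀ v w, B v w = B w v := QuadraticMap.associated_isSymm ℂ q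
  have hdim := LinearMap.finrank_range_add_finrank_ker B
  have hdimW : Module.finrank ℂ W = quadraticFormRank q := by
    have := Submodule.finrank_add_eq_of_isCompl hW
    change _ = Module.finrank ℂ (LinearMap.range B)
    omega
  have hdimK : Module.finrank ℂ (LinearMap.ker B) = Module.finrank ℂ (Fin t → ℂ) := by
    rw [Module.finrank_fin_fun]
    change Module.finrank ℂ (LinearMap.range B) + t = _ at hrank
    omega
  have hsep : (QuadraticMap.associated (q.comp W.subtype)).SeparatingLeft := by
    intro x hx
    have hx' : ∀ y : W, B x y = 0 := fun y => hx y
    have hmem : (x : V) ∈ LinearMap.ker B := by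
      rw [LinearMap.mem_ker]
      ext v
      obtain ⟨k, hk, w, hw, rfl⟩ := Submodule.mem_sup.mp
        (hW.sup_eq_top ▸ Submodule.mem_top : v ∈ LinearMap.ker B ⊔ W)
      rw [map_add, hx' ⟨w, hw⟩, hsymm, LinearMap.mem_ker.mp hk]
      simp
    exact Subtype.ext ((Submodule.disjoint_def.mp hW.disjoint) _ hmem x.2)
  obtain ⟨i⟩ := QuadraticForm.equivalent_weightedSumSquares_of_isAlgClosed _ hsep
  refine ⟨(Submodule.prodEquivOfIsCompl W _ hW.symm).symm.trans
    ((i.toLinearEquiv.trans (LinearEquiv.funCongrLeft ℂ ℂ (finCongr hdimW.symm))).prodCongr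
      (LinearEquiv.ofFinrankEq _ _ hdimK)), fun v => ?_⟩
  obtain ⟨⟨w, k⟩, rfl⟩ := (Submodule.prodEquivOfIsCompl W _ hW.symm).surjective v
  rw [LinearEquiv.trans_apply, LinearEquiv.symm_apply_apply]
  have hk : B k = 0 := k.2
  have h1 : q (w + k : V) = q w := by
    rw [← hself, map_add, hsymm, hsymm _ (k : V), hk, map_add, hsymm _ (k : V), hk, hself]
    simp
  have h2 : q (w : V) = ∑ j, i w j ^ 2 := by
    have := i.map_app w
    rw [QuadraticMap.weightedSumSquares_apply] at this
    simpa [pow_two] using this.symm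
  refine h1.trans (h2.trans ?_)
  exact (Equiv.sum_comp (finCongr hdimW.symm) fun j => i w j ^ 2).symm

lemma projectiveQuadric_eq_projSet (q : QuadraticForm ℂ V) :
    projectiveQuadric q = projSet {v | v ≠ 0 ∧ q v = 0} := by
  ext x
  constructor
  · intro h
    exact ⟨x.rep_nonzero, h _ (x.submodule_eq ▸ Submodule.mem_span_singleton_self _)⟩
  · rintro ⟨-, h⟩ v hv
    rw [x.submodule_eq] at hv
    obtain ⟨c, rfl⟩ := Submodule.mem_span_singleton.mp hv
    rw [QuadraticMap.map_smul, h, smul_zero]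

end QuadraticForms

lemma hasEulerChar_projectiveQuadric {V : Type} [AddCommGroup V] [Module ℂ V] [Module.Finite ℂ V]
    [TopologicalSpace V] [IsTopologicalAddGroup V] [ContinuousSMul ℂ V] [T2Space V]
    (q : QuadraticForm ℂ V) {t : ℕ} (hrank : quadraticFormRank q + t = Module.finrank ℂ V) :
    HasEulerChar (projectiveQuadric q)
      ((if Even (quadraticFormRank q) then (quadraticFormRank q : ℤ)
        else quadraticFormRank q - 1) + t) := by
  obtain ⟨e, he⟩ := exists_linearEquiv_sumSq q hrank
  have h := ((hasConeEulerChar_singularIsotropicCone (quadraticFormRank q) t).of_linearEquiv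
    e.toContinuousLinearEquiv).2.2
  have hS : e.toContinuousLinearEquiv ⁻¹' singularIsotropicCone (quadraticFormRank q) t =
      {v | v ≠ 0 ∧ q v = 0} := by
    ext v
    refine and_congr (not_congr (map_eq_zero_iff e e.injective)) ?_
    rw [he]
    rfl
  rwa [hS, ← projectiveQuadric_eq_projSet] at h

theorem lemma7p1 (n t : ℕ) (V : Type) [AddCommGroup V] [Module ℂ V] [Module.Finite ℂ V]
    [TopologicalSpace V] [IsTopologicalAddGroup V] [ContinuousSMul ℂ V] [T2Space V]
    (hV : Module.finrank ℂ V = 2 * n) (q : QuadraticForm ℂ V) (hq : q ≠ 0)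
    (hrank : quadraticFormRank q + t = 2 * n) :
    HasFiniteRationalHomology (projectiveQuadric q) ∧
      (Odd t → topologicalEulerChar (projectiveQuadric q) = 2 * (n : ℤ) - 1) ∧
      (Even t → topologicalEulerChar (projectiveQuadric q) = 2 * (n : ℤ)) := by
  obtain ⟨hfin, hχ⟩ := hasEulerChar_projectiveQuadric q (hrank.trans hV.symm)
  refine ⟨hfin, fun ht => ?_, fun ht => ?_⟩
  · have hr : ¬ Even (quadraticFormRank q) := fun hr =>
      Nat.not_even_iff_odd.mpr (hr.add_odd ht) (hrank ▸ even_two_mul n)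
    rw [hχ, if_neg hr]
    omega
  · have hr : Even (quadraticFormRank q) := (Nat.even_add.mp (hrank ▸ even_two_mul n)).mpr ht
    rw [hχ, if_pos hr]
    omega
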